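/- Let $F$ be a free group of finite rank at least $2$ and let $\phi:F\to F$ be an injective endomorphism. Definitions. A \emph{subgroup system} of $F$ is either the trivial system $\{1\}$, whose only component is the trivial subgroup, or a nonempty finite set of nontrivial subgroups of $F$, called its components; it is finitely generated if all its components are. A \emph{free factor system} is either the trivial system or a nonempty finite set $\{A_1,\dots,A_l\}$ of nontrivial subgroups of $F$ such that $\langle A_1,\dots,A_l\rangle$ is the internal free product $A_1*\cdots*A_l$ and is a free factor of $F$. A subgroup system $\mathcal A$ \emph{carries} a subgroup system $\mathcal B$ if for every $B\in\mathcal B$ there are $A\in\mathcal A$ and $x\in F$ with $B\le xAx^{-1}$; it carries the conjugacy class $[g]$ of $g\in F$ if $g\in xAx^{-1}$ for some $A\in\mathcal A$ and $x\in F$. Carrying is a preorder on free factor systems, and two free factor systems are equivalent if each carries the other. A subgroup system $\mathcal A=\{A_1,\dots,A_l\}$ is \emph{$[\phi]$-fixed} if there is a permutation $\sigma$ of $\{1,\dots,l\}$ such that $\phi(A_i)$ is conjugate in $F$ to $A_{\sigma(i)}$ for every $i$. A conjugacy class $[g]$ of $F$ \emph{has an infinite $[\phi]$-tail} if for every $n\ge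 1$ there is $g_n\in F$ such that $\phi^n(g_n)$ is conjugate to $g$ in $F$. Proposition. Among the $[\phi]$-fixed free factor systems of $F$, preordered by carrying, there is a maximal one $\mathcal A$, and it is unique up to equivalence. Moreover, $\mathcal A$ carries every conjugacy class of $F$ that has an infinite $[\phi]$-tail and every finitely generated $[\phi]$-fixed subgroup system of $F$. -/

import Mathlib

/-! Systems of subgroups of a group `F`: a system is a finite set of subgroups, its components. -/

namespace SubgroupSystem

variable {F : Type*} [Group F]

/-- The conjugate subgroup `x A x⁻¹`. -/
def conjBy (x : F) (A : Subgroup F) : Subgroup F :=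
  A.map (MulAut.conj x).toMonoidHom

/-- The trivial system `{1}`, or a nonempty finite set of nontrivial subgroups. -/
def IsSystem (𝒜 : Finset (Subgroup F)) : Prop :=
  𝒜 = {⊥} ∨ (𝒜.Nonempty ∧ ∀ A ∈ 𝒜, A ≠ ⊥)

/-- Every component is finitely generated. -/
def IsFG (𝒜 : Finset (Subgroup F)) : Prop :=
  ∀ A ∈ 𝒜, A.FG

/-- `F` is the internal free product of `A` and some subgroup `B`. -/
def IsFreeFactor (A : Subgroup F) : Prop :=
  ∃ B : Subgroup F, Function.Bijective (Monoid.Coprod.lift A.subtype B.subtype)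

/-- A nonempty finite set of nontrivial subgroups `A₁, …, Aₗ` such that the subgroup
`⟨A₁, …, Aₗ⟩` is the internal free product `A₁ * ⋯ * Aₗ` and is a free factor of `F`.
Consequently each `Aᵢ` is a free factor of `F`, and distinct components meet trivially. -/
def IsNontrivialFreeFactorSystem (𝒜 : Finset (Subgroup F)) : Prop :=
  𝒜.Nonempty ∧ (∀ A ∈ 𝒜, A ≠ ⊥) ∧
    Function.Injective (Monoid.CoprodI.lift fun A : 𝒜 => (A : Subgroup F).subtype) ∧
    IsFreeFactor (⨆ A ∈ 𝒜, A)

/-- The trivial system `{1}`, or a nontrivial free factor system. -/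
def IsFreeFactorSystem (𝒜 : Finset (Subgroup F)) : Prop :=
  𝒜 = {⊥} ∨ IsNontrivialFreeFactorSystem 𝒜

/-- `𝒜` carries `ℬ`: every component of `ℬ` lies in a conjugate of a component of `𝒜`. -/
def Carries (𝒜 ℬ : Finset (Subgroup F)) : Prop :=
  ∀ B ∈ ℬ, ∃ A ∈ 𝒜, ∃ x : F, B ≤ conjBy x A

/-- `𝒜` carries the conjugacy class of `g`. -/
def CarriesClass (𝒜 : Finset (Subgroup F)) (g : F) : Prop :=
  ∃ A ∈ 𝒜, ∃ x : F, g ∈ conjBy x A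

/-- The equivalence relation up to which free factor systems are considered. -/
def Equivalent (𝒜 ℬ : Finset (Subgroup F)) : Prop :=
  Carries 𝒜 ℬ ∧ Carries ℬ 𝒜

/-- `[φ]`-fixed: `φ` permutes the components up to conjugacy. -/
def IsFixed (φ : F →* F) (𝒜 : Finset (Subgroup F)) : Prop :=
  ∃ σ : Equiv.Perm 𝒜, ∀ A : 𝒜, ∃ x : F, (A : Subgroup F).map φ = conjBy x (σ A : Subgroup F)

/-- The conjugacy class of `g` has an infinite `[φ]`-tail. -/
def HasInfiniteTail (φ : F →* F) (g : F) : Prop :=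
  ∀ n : ℕ, 1 ≤ n → ∃ h : F, IsConj (φ^[n] h) g

/-- `𝒜` is a maximal element, for the carrying preorder, among the `[φ]`-fixed free factor
systems. -/
def IsMaximalFixedFreeFactorSystem (φ : F →* F) (𝒜 : Finset (Subgroup F)) : Prop :=
  IsFreeFactorSystem 𝒜 ∧ IsFixed φ 𝒜 ∧
    ∀ ℬ : Finset (Subgroup F), IsFreeFactorSystem ℬ → IsFixed φ ℬ → Carries ℬ 𝒜 → Carries 𝒜 ℬ

end SubgroupSystem

/-! The image of `φ ^ n` is a copy of `F` and is the fundamental group of its coset graph. Whatever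
`n` is, this graph has as many edges outside a spanning tree as `F` has basis elements. Call a
vertex short if a nontrivial closed path of length at most `M` is based there. Choose a tree that
also spans every component of every short subgraph (`exists_isSpanningTree_shortEdges`). The edges
outside it give a basis of `F`, and those in one short component generate a free factor. Every short
vertex is near one of these boundedly many edges, so short components have bounded diameter. Hence
the `φ ^ n`-images of these factors are generated, up to conjugacy, by elements of length bounded
independently of `n`. Conversely, any nontrivial subgroup whose `φ ^ n`-image has generators of
length at most `M`, up to conjugacy, is carried by one of the factors (`exists_adapted_basis`).

Only finitely many patterns and bounded generating sets occur, so for infinitely many `n` the images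
are conjugate to fixed subgroups `B i` (`exists_limit_system`). If `K` is finitely generated and
nontrivial with an infinite tail, then `K` is conjugate to `φ ^ n (L)`, where `L` is carried by a
factor at stage `n`; so `K` is carried by some `B i`. The `B i` have infinite tails themselves.
Those maximal for carrying are permuted by `φ` up to conjugacy: tails pull back through `φ`
(`SubgroupTail.exists_preimage`), and a finitely generated subgroup is never properly contained in a
conjugate of itself (`eq_conjBy_of_le`). Finally `φ ^ n` only permutes the maximal `B i`, so their
images stay bounded and each is conjugate to a factor given by part of a single basis. They
therefore form, up to conjugacy, a free factor system (`exists_fixed_freeFactorSystem`). It carries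
every fixed free factor system, which gives maximality and uniqueness. -/

namespace SubgroupSystem

/-! ### Word length in a free group -/

section Ball

variable {X : Type*}

/-- The elements of a free group that are spelled by a word of length at most `n`. -/
def wordBall (X : Type*) (n : ℕ) : Set (FreeGroup X) :=
  {g | ∃ L : List (X × Bool), L.length ≤ n ∧ FreeGroup.mk L = g}

lemma wordBall_finite [Finite X] (n : ℕ) : (wordBall X n).Finite := by
  refine ((List.finite_length_le (X × Bool) n).image FreeGroup.mk).subset ?_
  rintro g ⟨L, hL, rfl⟩
  exact ⟨L, hL, rfl⟩

lemma wordBall_mono {m n : ℕ} (h : m ≤ n) : wordBall X m ⊆ wordBall X n := by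
  rintro g ⟨L, hL, rfl⟩
  exact ⟨L, hL.trans h, rfl⟩

lemma exists_mem_wordBall (g : FreeGroup X) : ∃ n, g ∈ wordBall X n := by
  obtain ⟨L, rfl⟩ := Quot.exists_rep g
  exact ⟨L.length, L, le_rfl, rfl⟩

lemma one_mem_wordBall (n : ℕ) : (1 : FreeGroup X) ∈ wordBall X n :=
  ⟨[], by simp, rfl⟩

lemma of_mem_wordBall (x : X) : FreeGroup.of x ∈ wordBall X 1 :=
  ⟨[(x, true)], by simp, rfl⟩

lemma mul_mem_wordBall {m n : ℕ} {g h : FreeGroup X} (hg : g ∈ wordBall X m)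
    (hh : h ∈ wordBall X n) : g * h ∈ wordBall X (m + n) := by
  obtain ⟨L, hL, rfl⟩ := hg
  obtain ⟨L', hL', rfl⟩ := hh
  exact ⟨L ++ L', by simp; omega, by rw [FreeGroup.mul_mk]⟩

lemma inv_mem_wordBall {n : ℕ} {g : FreeGroup X} (hg : g ∈ wordBall X n) :
    g⁻¹ ∈ wordBall X n := by
  obtain ⟨L, hL, rfl⟩ := hg
  exact ⟨FreeGroup.invRev L, by simpa using hL, by rw [FreeGroup.inv_mk]⟩

lemma exists_forall_mem_wordBall {s : Set (FreeGroup X)} (hs : s.Finite) :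
    ∃ n, s ⊆ wordBall X n := by
  induction s, hs using Set.Finite.induction_on with
  | empty => exact ⟨0, by simp⟩
  | @insert a s _ _ ih =>
    obtain ⟨n, hn⟩ := ih
    obtain ⟨m, hm⟩ := exists_mem_wordBall a
    refine ⟨max m n, Set.insert_subset (wordBall_mono (le_max_left _ _) hm)
      (hn.trans (wordBall_mono (le_max_right _ _)))⟩

lemma mk_cons_true (x : X) (L : List (X × Bool)) :
    FreeGroup.mk ((x, true) :: L) = FreeGroup.of x * FreeGroup.mk L := by
  rw [FreeGroup.of, FreeGroup.mul_mk]; rfl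

lemma mk_cons_false (x : X) (L : List (X × Bool)) :
    FreeGroup.mk ((x, false) :: L) = (FreeGroup.of x)⁻¹ * FreeGroup.mk L := by
  rw [FreeGroup.of, FreeGroup.inv_mk, FreeGroup.mul_mk]; rfl

end Ball

/-! ### Paths in Schreier graphs -/

section Walk

variable {X V : Type*} [MulAction (FreeGroup X) V]

/-- `Walk S v n g`: the element `g` is spelled by a path of `n` edges that starts at `v` and uses
only edges in `S`, where `(u, x)` denotes the edge from `u` to `x • u`. -/
inductive Walk (S : Set (V × X)) (v : V) : ℕ → FreeGroup X → Prop
  | nil : Walk S v 0 1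
  | pos {n : ℕ} {g : FreeGroup X} {x : X} : Walk S v n g → (g • v, x) ∈ S →
      Walk S v (n + 1) (FreeGroup.of x * g)
  | neg {n : ℕ} {g : FreeGroup X} {x : X} : Walk S v n g →
      ((FreeGroup.of x)⁻¹ • g • v, x) ∈ S → Walk S v (n + 1) ((FreeGroup.of x)⁻¹ * g)

namespace Walk

variable {S S' : Set (V × X)} {v : V} {m n : ℕ} {g h : FreeGroup X}

lemma mono (w : Walk S v n g) (hS : S ⊆ S') : Walk S' v n g := by
  induction w with
  | nil => exact .nil
  | pos _ h ih => exact ih.pos (hS h)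
  | neg _ h ih => exact ih.neg (hS h)

lemma trans (w : Walk S v m g) {u : V} (hu : g • v = u) (w' : Walk S u n h) :
    Walk S v (m + n) (h * g) := by
  subst hu
  induction w' with
  | nil => simpa using w
  | pos _ h ih => rw [mul_assoc]; exact ih.pos (by rwa [mul_smul])
  | neg _ h ih => rw [mul_assoc]; exact ih.neg (by rwa [mul_smul])

lemma single_pos {x : X} (h : (v, x) ∈ S) : Walk S v 1 (FreeGroup.of x) := by
  simpa using (Walk.nil (S := S) (v := v)).pos (x := x) (by simpa using h)

lemma single_neg {x : X} {u : V} (h : (v, x) ∈ S) (hu : FreeGroup.of x • v = u) :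
    Walk S u 1 (FreeGroup.of x)⁻¹ := by
  subst hu
  simpa using (Walk.nil (S := S) (v := FreeGroup.of x • v)).neg (x := x) (by simpa using h)

lemma symm (w : Walk S v n g) {u : V} (hu : g • v = u) : Walk S u n g⁻¹ := by
  induction w generalizing u with
  | nil => simpa using Walk.nil
  | @pos n g x _ h ih =>
    rw [mul_inv_rev, add_comm]
    exact (single_neg h (by rwa [← mul_smul])).trans (by rw [← hu]; simp [mul_smul]) (ih rfl)
  | @neg n g x _ h ih =>
    rw [mul_inv_rev, add_comm, inv_inv]
    have : (FreeGroup.of x)⁻¹ • g • v = u := by rwa [← mul_smul]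
    rw [this] at h
    exact (single_pos h).trans (by rw [← this]; simp) (ih rfl)

lemma mem_wordBall (w : Walk S v n g) : g ∈ wordBall X n := by
  induction w with
  | nil => exact one_mem_wordBall 0
  | pos _ _ ih => rw [add_comm]; exact mul_mem_wordBall (of_mem_wordBall _) ih
  | neg _ _ ih =>
    rw [add_comm]; exact mul_mem_wordBall (inv_mem_wordBall (of_mem_wordBall _)) ih

lemma exists_split (w : Walk S v n g) {i : ℕ} (hi : i ≤ n) :
    ∃ g₁ g₂, g = g₂ * g₁ ∧ Walk S v i g₁ ∧ Walk S (g₁ • v) (n - i) g₂ := by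
  induction w with
  | nil =>
    obtain rfl : i = 0 := by omega
    exact ⟨1, 1, by simp, .nil, .nil⟩
  | @pos n g x w h ih =>
    rcases hi.lt_or_eq with hi | rfl
    · obtain ⟨g₁, g₂, rfl, w₁, w₂⟩ := ih (by omega)
      refine ⟨g₁, FreeGroup.of x * g₂, by rw [mul_assoc], w₁, ?_⟩
      rw [show n + 1 - i = n - i + 1 by omega]
      exact w₂.pos (by rwa [← mul_smul])
    · exact ⟨_, 1, by simp, w.pos h, by simpa using Walk.nil⟩
  | @neg n g x w h ih =>
    rcases hi.lt_or_eq with hi | rfl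
    · obtain ⟨g₁, g₂, rfl, w₁, w₂⟩ := ih (by omega)
      refine ⟨g₁, (FreeGroup.of x)⁻¹ * g₂, by rw [mul_assoc], w₁, ?_⟩
      rw [show n + 1 - i = n - i + 1 by omega]
      exact w₂.neg (by rwa [← mul_smul g₂])
    · exact ⟨_, 1, by simp, w.neg h, by simpa using Walk.nil⟩

/-- A walk in `S` either stays in `T`, or reaches the origin of an edge of `S` outside `T`. -/
lemma inside_or_exits (T : Set (V × X)) (w : Walk S v n g) :
    Walk T v n g ∨ ∃ f ∈ S, f ∉ T ∧ ∃ m ≤ n, ∃ h, Walk S v m h ∧ h • v = f.1 := by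
  induction w with
  | nil => exact .inl .nil
  | @pos n g x w h ih =>
    rcases ih with ih | ⟨f, hf, hfT, m, hm, k, hk⟩
    · by_cases hT : (g • v, x) ∈ T
      · exact .inl (ih.pos hT)
      · exact .inr ⟨_, h, hT, n, by omega, g, w, rfl⟩
    · exact .inr ⟨f, hf, hfT, m, by omega, k, hk⟩
  | @neg n g x w h ih =>
    rcases ih with ih | ⟨f, hf, hfT, m, hm, k, hk⟩
    · by_cases hT : ((FreeGroup.of x)⁻¹ • g • v, x) ∈ T
      · exact .inl (ih.neg hT)
      · exact .inr ⟨_, h, hT, n + 1, le_rfl, _, w.neg h, by simp [mul_smul]⟩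
    · exact .inr ⟨f, hf, hfT, m, by omega, k, hk⟩

/-- A walk only uses edges whose origin it can reach. -/
lemma reachable_edges (w : Walk S v n g) :
    Walk {f ∈ S | ∃ m h, Walk S v m h ∧ h • v = f.1} v n g := by
  induction w with
  | nil => exact .nil
  | @pos n g x w h ih => exact ih.pos ⟨h, n, g, w, rfl⟩
  | @neg n g x w h ih => exact ih.neg ⟨h, n + 1, _, w.neg h, by simp [mul_smul]⟩

lemma exists_finset (w : Walk S v n g) : ∃ s : Finset (V × X), ↑s ⊆ S ∧ Walk (↑s) v n g := by
  classical
  induction w with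
  | nil => exact ⟨∅, by simp, .nil⟩
  | @pos n g x w h ih =>
    obtain ⟨s, hs, w'⟩ := ih
    refine ⟨insert (g • v, x) s, by simp [Set.insert_subset_iff, h, hs], ?_⟩
    exact (w'.mono (by simp)).pos (by simp)
  | @neg n g x w h ih =>
    obtain ⟨s, hs, w'⟩ := ih
    refine ⟨insert ((FreeGroup.of x)⁻¹ • g • v, x) s, by simp [Set.insert_subset_iff, h, hs], ?_⟩
    exact (w'.mono (by simp)).neg (by simp)

/-- A function `s` on vertices expresses the label of a walk, up to `s` at its end points, through
the labels of its edges. -/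
lemma mem_closure (s : V → FreeGroup X) (w : Walk S v n g) :
    (s (g • v))⁻¹ * g * s v ∈ Subgroup.closure
      ((fun e : V × X => (s (FreeGroup.of e.2 • e.1))⁻¹ * FreeGroup.of e.2 * s e.1) '' S) := by
  induction w with
  | nil => simp
  | @pos n g x w h ih =>
    have h' := Subgroup.subset_closure (Set.mem_image_of_mem
      (fun e : V × X => (s (FreeGroup.of e.2 • e.1))⁻¹ * FreeGroup.of e.2 * s e.1) h)
    have := mul_mem h' ih
    simpa [mul_smul, mul_assoc] using this
  | @neg n g x w h ih =>
    have h' := Subgroup.subset_closure (Set.mem_image_of_mem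
      (fun e : V × X => (s (FreeGroup.of e.2 • e.1))⁻¹ * FreeGroup.of e.2 * s e.1) h)
    have := mul_mem (inv_mem h') ih
    simpa [mul_smul, mul_assoc] using this

end Walk

/-- The edges with both end points in `W`. -/
def inducedEdges (X : Type*) {V : Type*} [MulAction (FreeGroup X) V] (W : Set V) : Set (V × X) :=
  {e | e.1 ∈ W ∧ FreeGroup.of e.2 • e.1 ∈ W}

lemma walk_mk {W : Set V} {v : V} (L : List (X × Bool))
    (hL : ∀ L', L' <:+ L → FreeGroup.mk L' • v ∈ W) :
    Walk (inducedEdges X W) v L.length (FreeGroup.mk L) := by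
  induction L with
  | nil => exact .nil
  | cons a L ih =>
    have w := ih fun L' h => hL L' (h.trans (List.suffix_cons a L))
    have h₁ := hL L (List.suffix_cons a L)
    have h₂ := hL _ List.suffix_rfl
    obtain ⟨x, b⟩ := a
    cases b
    · rw [mk_cons_false, mul_smul] at h₂
      rw [mk_cons_false]
      exact w.neg ⟨h₂, by simpa using h₁⟩
    · rw [mk_cons_true, mul_smul] at h₂
      rw [mk_cons_true]
      exact w.pos ⟨h₁, h₂⟩

lemma exists_walk_univ (v : V) {n : ℕ} {g : FreeGroup X} (hg : g ∈ wordBall X n) :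
    ∃ m ≤ n, Walk Set.univ v m g := by
  obtain ⟨L, hL, rfl⟩ := hg
  exact ⟨_, hL, (walk_mk (W := Set.univ) L fun _ _ => trivial).mono (Set.subset_univ _)⟩

end Walk

/-! ### Spanning trees and free bases of stabilizers -/

section Tree

variable {X V : Type*} [MulAction (FreeGroup X) V]

/-- A set of edges without closed paths that connects every vertex to `v₀`. -/
structure IsSpanningTree (T : Set (V × X)) (v₀ : V) : Prop where
  eq_one : ∀ {v n g}, Walk T v n g → g • v = v → g = 1
  connected : ∀ v, ∃ n g, Walk T v₀ n g ∧ g • v₀ = v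

namespace IsSpanningTree

variable {T : Set (V × X)} {v₀ : V} (hT : IsSpanningTree T v₀)
include hT

/-- The element spelled by the path in the tree from the root to `v`. -/
noncomputable def path (v : V) : FreeGroup X := (hT.connected v).choose_spec.choose

lemma walk_path (v : V) : ∃ n, Walk T v₀ n (hT.path v) :=
  ⟨_, (hT.connected v).choose_spec.choose_spec.1⟩

lemma path_smul (v : V) : hT.path v • v₀ = v := (hT.connected v).choose_spec.choose_spec.2

lemma path_inv_smul (v : V) : (hT.path v)⁻¹ • v = v₀ := by
  rw [inv_smul_eq_iff, hT.path_smul]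

lemma path_root : hT.path v₀ = 1 :=
  hT.eq_one (hT.walk_path v₀).choose_spec (hT.path_smul v₀)

lemma path_of_walk {v : V} {n : ℕ} {g : FreeGroup X} (w : Walk T v n g) :
    hT.path (g • v) = g * hT.path v := by
  obtain ⟨m, hm⟩ := hT.walk_path v
  obtain ⟨k, hk⟩ := hT.walk_path (g • v)
  have := hT.eq_one (((hm.trans (hT.path_smul v) w)).trans (u := g • v)
    (by rw [mul_smul, hT.path_smul]) (hk.symm (hT.path_smul _)))
    (by rw [mul_smul, mul_smul, hT.path_smul, hT.path_inv_smul])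
  exact inv_mul_eq_one.mp this

/-- The element of the stabilizer of the root given by an edge. -/
noncomputable def edgeLoop (e : V × X) : FreeGroup X :=
  (hT.path (FreeGroup.of e.2 • e.1))⁻¹ * FreeGroup.of e.2 * hT.path e.1

lemma edgeLoop_smul (e : V × X) : hT.edgeLoop e • v₀ = v₀ := by
  rw [edgeLoop, mul_smul, mul_smul, hT.path_smul, hT.path_inv_smul]

lemma edgeLoop_eq_one {e : V × X} (he : e ∈ T) : hT.edgeLoop e = 1 := by
  rw [edgeLoop, hT.path_of_walk (Walk.single_pos (v := e.1) (x := e.2) he)]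
  group

lemma mem_closure_edgeLoop {S : Set (V × X)} {v : V} {n : ℕ} {g : FreeGroup X}
    (w : Walk S v n g) :
    (hT.path (g • v))⁻¹ * g * hT.path v ∈ Subgroup.closure (hT.edgeLoop '' (S \ T)) := by
  refine (Subgroup.closure_le _).mpr ?_ (w.mem_closure hT.path)
  rintro _ ⟨e, he, rfl⟩
  by_cases heT : e ∈ T
  · change hT.edgeLoop e ∈ _
    rw [hT.edgeLoop_eq_one heT]
    exact one_mem _
  · exact Subgroup.subset_closure ⟨e, ⟨he, heT⟩, rfl⟩

omit hT in
/-- The permutation of `V × FreeGroup Tᶜ` given by a generator, in which an edge outside `T` multiplies by its generator. -/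
noncomputable def labelStep (T : Set (V × X)) (x : X) :
    Equiv.Perm (V × FreeGroup ↥(Tᶜ)) := by
  classical
  let a : V → FreeGroup ↥(Tᶜ) := fun v => if h : (v, x) ∈ T then 1 else FreeGroup.of ⟨(v, x), h⟩
  exact
  { toFun := fun p => (FreeGroup.of x • p.1, a p.1 * p.2)
    invFun := fun p => ((FreeGroup.of x)⁻¹ • p.1, (a ((FreeGroup.of x)⁻¹ • p.1))⁻¹ * p.2)
    left_inv := fun p => by simp
    right_inv := fun p => by simp }

omit hT in
/-- The action of the free group in which the generators act by `labelStep`. -/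
noncomputable def label (T : Set (V × X)) :
    FreeGroup X →* Equiv.Perm (V × FreeGroup ↥(Tᶜ)) :=
  FreeGroup.lift (labelStep T)

omit hT in
lemma label_of_mem {v : V} {x : X} (h : (v, x) ∈ T) (a : FreeGroup ↥(Tᶜ)) :
    label T (FreeGroup.of x) (v, a) = (FreeGroup.of x • v, a) := by
  simp [label, labelStep, h]

omit hT in
lemma label_of_notMem {v : V} {x : X} (h : (v, x) ∉ T) (a : FreeGroup ↥(Tᶜ)) :
    label T (FreeGroup.of x) (v, a) = (FreeGroup.of x • v, FreeGroup.of ⟨(v, x), h⟩ * a) := by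
  simp [label, labelStep, h]

omit hT in
lemma label_walk {v : V} {n : ℕ} {g : FreeGroup X} (w : Walk T v n g) (a : FreeGroup ↥(Tᶜ)) :
    label T g (v, a) = (g • v, a) := by
  induction w with
  | nil => simp
  | pos w h ih => rw [map_mul, Equiv.Perm.mul_apply, ih, label_of_mem h, mul_smul]
  | @neg n g x w h ih =>
    rw [map_mul, Equiv.Perm.mul_apply, ih, map_inv, Equiv.Perm.inv_eq_iff_eq, mul_smul,
      label_of_mem h, smul_inv_smul]

/-- Tree paths leave the second coordinate alone, so only the crossing of `e` is recorded. Acting on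
`(v₀, 1)` therefore recovers a word in the loops, which proves that they are free. -/
lemma label_edgeLoop (e : ↥(Tᶜ)) (a : FreeGroup ↥(Tᶜ)) :
    label T (hT.edgeLoop e) (v₀, a) = (v₀, FreeGroup.of e * a) := by
  obtain ⟨⟨v, x⟩, he⟩ := e
  obtain ⟨n, hn⟩ := hT.walk_path v
  obtain ⟨m, hm⟩ := hT.walk_path (FreeGroup.of x • v)
  rw [edgeLoop, map_mul, map_mul, Equiv.Perm.mul_apply, Equiv.Perm.mul_apply, label_walk hn,
    hT.path_smul, label_of_notMem he, map_inv, Equiv.Perm.inv_eq_iff_eq, label_walk hm,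
    hT.path_smul]

lemma label_lift_edgeLoop (w a : FreeGroup ↥(Tᶜ)) :
    label T (FreeGroup.lift (fun e : ↥(Tᶜ) => hT.edgeLoop e) w) (v₀, a) = (v₀, w * a) := by
  induction w using FreeGroup.induction_on generalizing a with
  | C1 => simp
  | of e => rw [FreeGroup.lift_apply_of, hT.label_edgeLoop]
  | inv_of e ih =>
    rw [map_inv, map_inv, Equiv.Perm.inv_eq_iff_eq, ih, mul_inv_cancel_left]
  | mul x y hx hy => rw [map_mul, map_mul, Equiv.Perm.mul_apply, hy, hx, mul_assoc]

lemma lift_edgeLoop_injective :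
    Function.Injective (FreeGroup.lift fun e : ↥(Tᶜ) => hT.edgeLoop e) := by
  rw [injective_iff_map_eq_one]
  intro w hw
  simpa [hw] using (hT.label_lift_edgeLoop w 1).symm

lemma range_lift_edgeLoop :
    (FreeGroup.lift fun e : ↥(Tᶜ) => hT.edgeLoop e).range =
      MulAction.stabilizer (FreeGroup X) v₀ := by
  apply le_antisymm
  · rw [FreeGroup.range_lift_eq_closure, Subgroup.closure_le]
    rintro _ ⟨e, rfl⟩
    exact hT.edgeLoop_smul e
  · intro g hg
    obtain ⟨n, hn⟩ := exists_mem_wordBall g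
    obtain ⟨m, -, w⟩ := exists_walk_univ v₀ hn
    have := hT.mem_closure_edgeLoop w
    rw [MulAction.mem_stabilizer_iff.mp hg, hT.path_root] at this
    rw [FreeGroup.range_lift_eq_closure]
    convert this using 2
    · ext; simp
    · simp

end IsSpanningTree

end Tree

/-! ### Minimal spanning trees for a well-ordering of the edges -/

section Kruskal

variable {X V : Type*} [MulAction (FreeGroup X) V]

/-- An edge joining two vertices that are not connected in `S`: up to cancellation, a walk in
`insert e S` crosses `e` at most once. -/
lemma Walk.normal_form {S : Set (V × X)} {o : V} {x : X}
    (hS : ∀ {v n g}, Walk S v n g → g • v = v → g = 1)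
    (he : ¬∃ n g, Walk S o n g ∧ g • o = FreeGroup.of x • o) {v : V} {n : ℕ} {g : FreeGroup X}
    (w : Walk (insert (o, x) S) v n g) :
    (∃ m, Walk S v m g) ∨
    (∃ m m' g₁ g₂, g = g₂ * FreeGroup.of x * g₁ ∧ Walk S v m g₁ ∧ g₁ • v = o ∧
      Walk S (FreeGroup.of x • o) m' g₂) ∨
    (∃ m m' g₁ g₂, g = g₂ * (FreeGroup.of x)⁻¹ * g₁ ∧ Walk S v m g₁ ∧
      g₁ • v = FreeGroup.of x • o ∧ Walk S o m' g₂) := by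
  induction w with
  | nil => exact .inl ⟨0, .nil⟩
  | @pos n g y w h ih =>
    -- A second crossing in the opposite direction follows a closed walk in `S`, trivial by `hS`, so
    -- the two crossings cancel. One in the same direction would follow a walk in `S` joining the
    -- end points of the edge, against `he`.
    rcases ih with ⟨m, ih⟩ | ⟨m, m', g₁, g₂, rfl, w₁, h₁, w₂⟩ | ⟨m, m', g₁, g₂, rfl, w₁, h₁, w₂⟩
    · rcases h with h | h
      · obtain ⟨h', rfl⟩ := Prod.mk.inj h
        exact .inr (.inl ⟨m, 0, g, 1, by simp, ih, h', .nil⟩)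
      · exact .inl ⟨_, ih.pos h⟩
    · rw [mul_smul, mul_smul, h₁] at h
      rcases h with h | h
      · exact absurd ⟨_, _, w₂.symm (Prod.mk.inj h).1, by rw [inv_smul_eq_iff, (Prod.mk.inj h).1]⟩ he
      · exact .inr (.inl ⟨_, _, g₁, FreeGroup.of y * g₂, by simp [mul_assoc], w₁, h₁, w₂.pos h⟩)
    · rw [mul_smul, mul_smul, h₁, inv_smul_smul] at h
      rcases h with h | h
      · obtain ⟨h', rfl⟩ := Prod.mk.inj h
        obtain rfl := hS w₂ h'
        exact .inl ⟨_, by simpa using w₁⟩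
      · exact .inr (.inr ⟨_, _, g₁, FreeGroup.of y * g₂, by simp [mul_assoc], w₁, h₁, w₂.pos h⟩)
  | @neg n g y w h ih =>
    rcases ih with ⟨m, ih⟩ | ⟨m, m', g₁, g₂, rfl, w₁, h₁, w₂⟩ | ⟨m, m', g₁, g₂, rfl, w₁, h₁, w₂⟩
    · rcases h with h | h
      · obtain ⟨h', rfl⟩ := Prod.mk.inj h
        exact .inr (.inr ⟨m, 0, g, 1, by simp, ih, inv_smul_eq_iff.mp h', .nil⟩)
      · exact .inl ⟨_, ih.neg h⟩
    · rw [mul_smul, mul_smul, h₁] at h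
      rcases h with h | h
      · obtain ⟨h', rfl⟩ := Prod.mk.inj h
        obtain rfl := hS w₂ (inv_smul_eq_iff.mp h')
        exact .inl ⟨_, by simpa using w₁⟩
      · exact .inr (.inl ⟨_, _, g₁, (FreeGroup.of y)⁻¹ * g₂, by simp [mul_assoc], w₁, h₁,
          w₂.neg h⟩)
    · rw [mul_smul, mul_smul, h₁, inv_smul_smul] at h
      rcases h with h | h
      · obtain ⟨h', rfl⟩ := Prod.mk.inj h
        exact absurd ⟨_, _, w₂, inv_smul_eq_iff.mp h'⟩ he
      · exact .inr (.inr ⟨_, _, g₁, (FreeGroup.of y)⁻¹ * g₂, by simp [mul_assoc], w₁, h₁,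
          w₂.neg h⟩)

/-- The edges whose end points are not connected by edges that precede them. -/
def kruskalTree {O : Type*} [LT O] (κ : V × X → O) : Set (V × X) :=
  {e | ¬∃ n g, Walk {f | κ f < κ e} e.1 n g ∧ g • e.1 = FreeGroup.of e.2 • e.1}

variable {O : Type*} [LinearOrder O] {κ : V × X → O}

/-- A closed path uses finitely many edges. If it crossed the last of them essentially, the rest of
the path would join the end points of that edge by earlier edges. -/
lemma kruskalTree_eq_one (hκ : Function.Injective κ) {v : V} {n : ℕ} {g : FreeGroup X}
    (w : Walk (kruskalTree κ) v n g) (hg : g • v = v) : g = 1 := by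
  classical
  obtain ⟨s, hs, w'⟩ := w.exists_finset
  suffices H : ∀ s : Finset (V × X), ↑s ⊆ kruskalTree κ → ∀ v n g, Walk (↑s : Set (V × X)) v n g →
      g • v = v → g = 1 from H s hs v n g w' hg
  clear w w' hs hg v n g s
  intro s
  induction s using Finset.induction_on_max_value κ with
  | empty =>
    intro _ v n g w _
    cases w with
    | nil => rfl
    | pos _ h => simp at h
    | neg _ h => simp at h
  | insert e s hes hmax ih =>
    intro hs v n g w hg
    obtain ⟨o, x⟩ := e
    rw [Finset.coe_insert] at hs w
    have ih' : ∀ {v n g}, Walk (↑s : Set (V × X)) v n g → g • v = v → g = 1 :=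
      fun w h => ih ((Set.subset_insert _ _).trans hs) _ _ _ w h
    have hT : ¬∃ n g, Walk (↑s : Set (V × X)) o n g ∧ g • o = FreeGroup.of x • o := by
      rintro ⟨n, g, w, hg⟩
      refine hs (Set.mem_insert _ _) ⟨n, g, w.mono fun f hf => ?_, hg⟩
      exact (hmax f hf).lt_of_ne fun h => hes (hκ h ▸ hf)
    rcases w.normal_form ih' hT with
      ⟨m, w⟩ | ⟨m, m', g₁, g₂, rfl, w₁, h₁, w₂⟩ | ⟨m, m', g₁, g₂, rfl, w₁, h₁, w₂⟩
    · exact ih' w hg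
    · rw [mul_smul, mul_smul, h₁] at hg
      exact absurd ⟨_, _, (w₂.trans hg w₁).symm (u := o) (by rw [mul_smul, hg, h₁]),
        by rw [inv_smul_eq_iff, mul_smul, hg, h₁]⟩ hT
    · rw [mul_smul, mul_smul, h₁, inv_smul_smul] at hg
      exact absurd ⟨_, _, w₂.trans hg w₁, by rw [mul_smul, hg, h₁]⟩ hT

lemma exists_walk_of_edges {S S' : Set (V × X)}
    (h : ∀ e ∈ S, ∃ n g, Walk S' e.1 n g ∧ g • e.1 = FreeGroup.of e.2 • e.1) {v : V} {n : ℕ}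
    {g : FreeGroup X} (w : Walk S v n g) : ∃ m k, Walk S' v m k ∧ k • v = g • v := by
  induction w with
  | nil => exact ⟨0, 1, .nil, rfl⟩
  | @pos n g x w hx ih =>
    obtain ⟨m, k, wk, hk⟩ := ih
    obtain ⟨m', k', wk', hk'⟩ := h _ hx
    exact ⟨_, _, wk.trans hk wk', by rw [mul_smul, hk, hk', mul_smul]⟩
  | @neg n g x w hx ih =>
    obtain ⟨m, k, wk, hk⟩ := ih
    obtain ⟨m', k', wk', hk'⟩ := h _ hx
    simp only [smul_inv_smul] at hk'
    refine ⟨_, _, wk.trans hk (wk'.symm hk'), ?_⟩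
    rw [mul_smul, hk, inv_smul_eq_iff, mul_smul, hk']

lemma kruskalTree_spans [WellFoundedLT O] (e : V × X) :
    ∃ n g, Walk (kruskalTree κ ∩ {f | κ f ≤ κ e}) e.1 n g ∧ g • e.1 = FreeGroup.of e.2 • e.1 := by
  induction hk : κ e using WellFoundedLT.induction generalizing e with
  | ind a ih =>
    subst hk
    by_cases he : e ∈ kruskalTree κ
    · exact ⟨1, _, Walk.single_pos ⟨he, le_refl (κ e)⟩, rfl⟩
    · obtain ⟨n, g, w, hg⟩ := not_not.mp he
      obtain ⟨m, k, wk, hk⟩ := exists_walk_of_edges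
        (S' := kruskalTree κ ∩ {f | κ f ≤ κ e}) (fun f hf => by
          obtain ⟨n', g', w', h'⟩ := ih _ hf f rfl
          exact ⟨n', g', w'.mono fun _ h => ⟨h.1, le_trans h.2 (le_of_lt hf)⟩, h'⟩) w
      exact ⟨m, k, wk, hk.trans hg⟩

/-- A spanning tree that is compatible with all the sublevel sets of a function on the edges. -/
theorem exists_isSpanningTree [MulAction.IsPretransitive (FreeGroup X) V] (ℓ : V × X → ℕ)
    (v₀ : V) : ∃ T : Set (V × X), IsSpanningTree T v₀ ∧ ∀ (M n : ℕ) (v : V) (g : FreeGroup X),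
      Walk {e | ℓ e ≤ M} v n g → ∃ m k, Walk (T ∩ {e | ℓ e ≤ M}) v m k ∧ k • v = g • v := by
  -- The level dominates, so replacing an edge by earlier ones stays in the sublevel set. The
  -- cardinal only breaks ties, making the order injective and well-founded.
  let κ : V × X → ℕ ×ₗ Cardinal := fun e => toLex (ℓ e, embeddingToCardinal e)
  have hκ : Function.Injective κ := fun e f h =>
    embeddingToCardinal.injective (Prod.mk.inj (toLex.injective h)).2
  have hle : ∀ e f, κ f ≤ κ e → ℓ f ≤ ℓ e := fun e f h => (Prod.Lex.monotone_fst _ _ h :)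
  refine ⟨kruskalTree κ, ⟨fun w => kruskalTree_eq_one hκ w, fun v => ?_⟩, fun M n v g w => ?_⟩
  · obtain ⟨g, rfl⟩ := MulAction.exists_smul_eq (FreeGroup X) v₀ v
    obtain ⟨n, hn⟩ := exists_mem_wordBall g
    obtain ⟨m, -, w⟩ := exists_walk_univ v₀ hn
    refine exists_walk_of_edges (fun e _ => ?_) w
    obtain ⟨n', g', w', h'⟩ := kruskalTree_spans (κ := κ) e
    exact ⟨n', g', w'.mono Set.inter_subset_left, h'⟩
  · refine exists_walk_of_edges (fun e he => ?_) w
    obtain ⟨n', g', w', h'⟩ := kruskalTree_spans (κ := κ) e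
    exact ⟨n', g', w'.mono fun f hf => ⟨hf.1, (hle e f hf.2).trans he⟩, h'⟩

end Kruskal

/-! ### Conjugate subgroups -/

section Conj

variable {G : Type*} [Group G]

lemma mem_conjBy {x g : G} {A : Subgroup G} : g ∈ conjBy x A ↔ x⁻¹ * g * x ∈ A := by
  rw [conjBy, Subgroup.mem_map]
  constructor
  · rintro ⟨a, ha, rfl⟩
    simpa [mul_assoc] using ha
  · intro h
    exact ⟨_, h, by simp [mul_assoc]⟩

@[simp] lemma conjBy_one (A : Subgroup G) : conjBy 1 A = A := by
  ext; simp [mem_conjBy]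

lemma conjBy_conjBy (x y : G) (A : Subgroup G) : conjBy x (conjBy y A) = conjBy (x * y) A := by
  ext; simp [mem_conjBy, mul_assoc]

lemma conjBy_mono (x : G) {A B : Subgroup G} (h : A ≤ B) : conjBy x A ≤ conjBy x B :=
  Subgroup.map_mono h

lemma conjBy_le_iff {x : G} {A B : Subgroup G} : conjBy x A ≤ B ↔ A ≤ conjBy x⁻¹ B := by
  constructor <;> intro h
  · simpa [conjBy_conjBy] using conjBy_mono x⁻¹ h
  · simpa [conjBy_conjBy] using conjBy_mono x h

lemma map_conjBy {H : Type*} [Group H] (f : G →* H) (x : G) (A : Subgroup G) :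
    (conjBy x A).map f = conjBy (f x) (A.map f) := by
  rw [conjBy, conjBy, Subgroup.map_map, Subgroup.map_map]
  congr 1
  ext
  simp

lemma conjBy_eq_bot_iff {x : G} {A : Subgroup G} : conjBy x A = ⊥ ↔ A = ⊥ :=
  Subgroup.map_eq_bot_iff_of_injective _ (MulAut.conj x).injective

end Conj

/-! ### Components of the graph of short loops -/

section ShortLoops

variable {X V : Type*} [MulAction (FreeGroup X) V]

/-- The vertices at which a nontrivial closed path of length at most `M` is based. -/
def shortVertices (X : Type*) (V : Type*) [MulAction (FreeGroup X) V] (M : ℕ) : Set V :=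
  {v | ∃ w ∈ wordBall X M, w ≠ 1 ∧ w • v = v}

/-- The edges between vertices at which a short nontrivial closed path is based. -/
def shortEdges (X : Type*) (V : Type*) [MulAction (FreeGroup X) V] (M : ℕ) : Set (V × X) :=
  inducedEdges X (shortVertices X V M)

lemma shortEdges_mono {M N : ℕ} (h : M ≤ N) : shortEdges X V M ⊆ shortEdges X V N := by
  have : shortVertices X V M ⊆ shortVertices X V N :=
    fun v ⟨w, hw, h'⟩ => ⟨w, wordBall_mono h hw, h'⟩
  exact fun e he => ⟨this he.1, this he.2⟩

/-- Every vertex on a short closed path is the base of a cyclic rotation of it, which is again short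
and nontrivial. -/
lemma exists_walk_shortEdges {M : ℕ} {v : V} {g : FreeGroup X} (hg : g ∈ wordBall X M)
    (hv : g • v = v) : ∃ m ≤ M, Walk (shortEdges X V M) v m g := by
  by_cases h1 : g = 1
  · exact ⟨0, Nat.zero_le _, h1 ▸ .nil⟩
  obtain ⟨L, hL, rfl⟩ := hg
  refine ⟨L.length, hL, walk_mk L ?_⟩
  rintro L₂ ⟨L₁, rfl⟩
  rw [← FreeGroup.mul_mk] at h1 hv
  refine ⟨FreeGroup.mk L₂ * FreeGroup.mk L₁, ⟨L₂ ++ L₁, ?_, FreeGroup.mul_mk.symm⟩, ?_, ?_⟩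
  · simp only [List.length_append] at hL ⊢
    omega
  · intro h
    exact h1 (mul_eq_one_comm.mp h)
  · rw [mul_smul, ← mul_smul (FreeGroup.mk L₁), hv]

lemma Walk.end_mem_shortVertices {M n : ℕ} {v : V} {g : FreeGroup X}
    (w : Walk (shortEdges X V M) v n g) (hv : v ∈ shortVertices X V M) :
    g • v ∈ shortVertices X V M := by
  induction w with
  | nil => simpa using hv
  | pos _ h _ => rw [mul_smul]; exact h.2
  | neg _ h _ => rw [mul_smul]; exact h.1

/-- If no vertex stabilizer is trivial, then there is a spanning tree that spans all the components
of all the graphs of short edges. -/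
theorem exists_isSpanningTree_shortEdges [MulAction.IsPretransitive (FreeGroup X) V] (v₀ : V)
    (h₀ : MulAction.stabilizer (FreeGroup X) v₀ ≠ ⊥) :
    ∃ T : Set (V × X), IsSpanningTree T v₀ ∧ ∀ (M n : ℕ) (v : V) (g : FreeGroup X),
      Walk (shortEdges X V M) v n g →
        ∃ m k, Walk (T ∩ shortEdges X V M) v m k ∧ k • v = g • v := by
  -- By transitivity a nontrivial stabilizer element can be conjugated to any vertex. So the short
  -- graphs exhaust the graph, and the least `M` at which an edge is short is a level function.
  have hv : ∀ v : V, ∃ M, v ∈ shortVertices X V M := by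
    intro v
    obtain ⟨g, rfl⟩ := MulAction.exists_smul_eq (FreeGroup X) v₀ v
    obtain ⟨⟨w, hw⟩, hw1⟩ := Subgroup.ne_bot_iff_exists_ne_one.mp h₀
    obtain ⟨M, hM⟩ := exists_mem_wordBall (g * w * g⁻¹)
    refine ⟨M, _, hM, by simpa [Subtype.ext_iff] using hw1, ?_⟩
    rw [mul_smul, mul_smul, inv_smul_smul, MulAction.mem_stabilizer_iff.mp hw]
  have he : ∀ e : V × X, ∃ M, e ∈ shortEdges X V M := by
    intro e
    obtain ⟨M, hM⟩ := hv e.1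
    obtain ⟨N, hN⟩ := hv (FreeGroup.of e.2 • e.1)
    obtain ⟨w, hw, h⟩ := hM
    obtain ⟨w', hw', h'⟩ := hN
    exact ⟨max M N, ⟨w, wordBall_mono (le_max_left _ _) hw, h⟩,
      ⟨w', wordBall_mono (le_max_right _ _) hw', h'⟩⟩
  classical
  have hℓ : ∀ M, {e : V × X | Nat.find (he e) ≤ M} = shortEdges X V M := by
    intro M
    ext e
    exact ⟨fun h => shortEdges_mono h (Nat.find_spec (he e)), fun h => Nat.find_min' _ h⟩
  obtain ⟨T, hT, h⟩ := exists_isSpanningTree (fun e : V × X => Nat.find (he e)) v₀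
  refine ⟨T, hT, fun M n v g w => ?_⟩
  rw [← hℓ] at w ⊢
  exact h M n v g w

variable {T : Set (V × X)} {v₀ : V}

lemma IsSpanningTree.exists_exit (hT : IsSpanningTree T v₀) {S : Set (V × X)} {v : V} {n : ℕ}
    {g : FreeGroup X} (w : Walk S v n g) (hv : g • v = v) (h1 : g ≠ 1) :
    ∃ f ∈ S, f ∉ T ∧ ∃ m ≤ n, ∃ h, Walk S v m h ∧ h • v = f.1 :=
  (w.inside_or_exits T).resolve_left fun w' => h1 (hT.eq_one w' hv)

/-- The closed path spelled by `g` at a fixed vertex must leave the tree, so that vertex is within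
bounded distance of one of finitely many edges. -/
lemma IsSpanningTree.finite_fixedPoints [Finite X] [Finite ↥(Tᶜ)] (hT : IsSpanningTree T v₀)
    {g : FreeGroup X} (h1 : g ≠ 1) : {v : V | g • v = v}.Finite := by
  obtain ⟨n, hn⟩ := exists_mem_wordBall g
  refine (((wordBall_finite (X := X) n).prod (Set.finite_univ (α := ↥(Tᶜ)))).image
    fun p => p.1⁻¹ • p.2.1.1).subset ?_
  intro v hv
  obtain ⟨m, hm, w⟩ := exists_walk_univ v hn
  obtain ⟨f, -, hf, k, hk, h, wh, hh⟩ := hT.exists_exit w hv h1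
  exact ⟨(h, ⟨f, hf⟩), ⟨wordBall_mono (hk.trans hm) wh.mem_wordBall, trivial⟩,
    by simp [← hh]⟩

/-- Take a shortest walk and mark its vertices at multiples of `2 * M + 1`. Each is within `M` of an
edge outside `T`. If the walk were too long, two marks would share that edge, and a detour through
it of length at most `2 * M` would be a shortcut. -/
lemma IsSpanningTree.exists_bounded_walk [Finite ↥(Tᶜ)] (hT : IsSpanningTree T v₀) {M n : ℕ}
    {v : V} (hv : v ∈ shortVertices X V M) {g : FreeGroup X}
    (w : Walk (shortEdges X V M) v n g) :
    ∃ m ≤ Nat.card ↥(Tᶜ) * (2 * M + 1), ∃ h, Walk (shortEdges X V M) v m h ∧ h • v = g • v := by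
  classical
  have hex : ∃ m, ∃ h, Walk (shortEdges X V M) v m h ∧ h • v = g • v := ⟨n, g, w, rfl⟩
  obtain ⟨h, wh, hh⟩ := Nat.find_spec hex
  refine ⟨Nat.find hex, ?_, h, wh, hh⟩
  by_contra! hlt
  set r := Nat.card ↥(Tᶜ) with hr
  have key : ∀ i : Fin (r + 1), ∃ (f : ↥(Tᶜ)) (g₁ g₂ k : FreeGroup X) (m : ℕ), h = g₂ * g₁ ∧
      Walk (shortEdges X V M) v (i * (2 * M + 1)) g₁ ∧
      Walk (shortEdges X V M) (g₁ • v) (Nat.find hex - i * (2 * M + 1)) g₂ ∧ m ≤ M ∧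
      Walk (shortEdges X V M) (g₁ • v) m k ∧ k • g₁ • v = f.1.1 := by
    intro i
    have hi : (i : ℕ) * (2 * M + 1) ≤ Nat.find hex :=
      (Nat.mul_le_mul_right _ (Nat.lt_succ_iff.mp i.2)).trans hlt.le
    obtain ⟨g₁, g₂, e, w₁, w₂⟩ := wh.exists_split hi
    obtain ⟨c, hc, hc1, hcv⟩ := w₁.end_mem_shortVertices hv
    obtain ⟨m, hm, wc⟩ := exists_walk_shortEdges hc hcv
    obtain ⟨f, -, hf, m', hm', k, wk, hk⟩ := hT.exists_exit wc hcv hc1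
    exact ⟨⟨f, hf⟩, g₁, g₂, k, m', e, w₁, w₂, hm'.trans hm, wk, hk⟩
  choose f g₁ g₂ k m hg w₁ w₂ hm wk hk using key
  have : Fintype ↥(Tᶜ) := Fintype.ofFinite _
  obtain ⟨i, j, hij, hf⟩ : ∃ i j : Fin (r + 1), i < j ∧ f i = f j := by
    obtain ⟨i, j, hij, hf⟩ := Fintype.exists_ne_map_eq_of_card_lt f
      (by rw [hr, Nat.card_eq_fintype_card, Fintype.card_fin]; exact Nat.lt_succ_self _)
    rcases hij.lt_or_gt with h | h
    · exact ⟨i, j, h, hf⟩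
    · exact ⟨j, i, h, hf.symm⟩
  have w' := (((w₁ i).trans rfl (wk i)).trans (by rw [mul_smul, hk, hf])
    ((wk j).symm (hk j))).trans (u := g₁ j • v)
      (by rw [mul_smul, mul_smul, hk, hf, ← hk j, inv_smul_smul]) (w₂ j)
  have hend : (g₂ j * ((k j)⁻¹ * (k i * g₁ i))) • v = g • v := by
    rw [mul_smul, mul_smul, mul_smul, hk, hf, ← hk j, inv_smul_smul, ← mul_smul, ← hg, hh]
  refine Nat.find_min hex ?_ ⟨_, w', hend⟩
  have hj : (j : ℕ) * (2 * M + 1) ≤ Nat.find hex :=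
      (Nat.mul_le_mul_right _ (Nat.lt_succ_iff.mp j.2)).trans hlt.le
  have hij' : ((i : ℕ) + 1) * (2 * M + 1) ≤ j * (2 * M + 1) := Nat.mul_le_mul_right _ hij
  rw [add_mul, one_mul] at hij'
  have := hm i
  have := hm j
  omega

/-- Two edges outside `T` lie in the same component of the graph of short edges. -/
def Linked (T : Set (V × X)) (M : ℕ) (e f : ↥(Tᶜ)) : Prop :=
  e.1 ∈ shortEdges X V M ∧ f.1 ∈ shortEdges X V M ∧
    ∃ n g, Walk (shortEdges X V M) e.1.1 n g ∧ g • e.1.1 = f.1.1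

lemma Linked.mono {M N : ℕ} (h : M ≤ N) {e f : ↥(Tᶜ)} (hl : Linked T M e f) : Linked T N e f :=
  ⟨shortEdges_mono h hl.1, shortEdges_mono h hl.2.1, hl.2.2.imp fun _ ⟨g, w, hg⟩ =>
    ⟨g, w.mono (shortEdges_mono h), hg⟩⟩

lemma Linked.symm {M : ℕ} {e f : ↥(Tᶜ)} (hl : Linked T M e f) : Linked T M f e := by
  obtain ⟨he, hf, n, g, w, hg⟩ := hl
  exact ⟨hf, he, n, g⁻¹, w.symm hg, by rw [← hg, inv_smul_smul]⟩

lemma Linked.trans {M : ℕ} {e f k : ↥(Tᶜ)} (hl : Linked T M e f) (hl' : Linked T M f k) :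
    Linked T M e k := by
  obtain ⟨he, hf, n, g, w, hg⟩ := hl
  obtain ⟨-, hk, n', g', w', hg'⟩ := hl'
  exact ⟨he, hk, _, _, w.trans hg w', by rw [mul_smul, hg, hg']⟩

variable (hT : IsSpanningTree T v₀)

/-- The subgroup generated by the basis elements linked to `e`. -/
noncomputable def IsSpanningTree.component (M : ℕ) (e : ↥(Tᶜ)) : Subgroup (FreeGroup X) :=
  Subgroup.closure ((fun f : ↥(Tᶜ) => hT.edgeLoop f) '' {f | Linked T M e f})

/-- The loop is a product of the basis elements of the edges outside `T` that it crosses, and these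
edges all lie in the component of `e`. -/
lemma IsSpanningTree.loop_mem_component {M : ℕ} {e : ↥(Tᶜ)} (he : e.1 ∈ shortEdges X V M) {v : V}
    {n : ℕ} {g : FreeGroup X} (w : Walk (shortEdges X V M) v n g) (hg : g • v = e.1.1) {m : ℕ}
    {h : FreeGroup X} (wh : Walk (shortEdges X V M) v m h) (hv : h • v = v) :
    (hT.path v)⁻¹ * h * hT.path v ∈ hT.component M e := by
  have := hT.mem_closure_edgeLoop wh.reachable_edges
  rw [hv] at this
  refine Subgroup.closure_mono ?_ this
  rintro _ ⟨f, ⟨⟨hf, k, c, wc, hc⟩, hfT⟩, rfl⟩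
  exact ⟨⟨f, hfT⟩, ⟨he, hf, _, _, (w.symm hg).trans (by rw [← hg, inv_smul_smul]) wc,
    by rw [mul_smul, ← hg, inv_smul_smul, hc]⟩, rfl⟩

/-- A subgroup that fixes `v` and is generated by short elements is carried by a component. -/
lemma IsSpanningTree.exists_component {M : ℕ} {s : Set (FreeGroup X)} (hs : s ⊆ wordBall X M)
    {v : V} (hv : ∀ g ∈ s, g • v = v) (hne : Subgroup.closure s ≠ ⊥) :
    ∃ e, Linked T M e e ∧ Subgroup.closure s ≤ conjBy (hT.path v) (hT.component M e) := by
  obtain ⟨a, ha, ha1⟩ : ∃ a ∈ s, a ≠ 1 := by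
    by_contra! h
    exact hne ((Subgroup.closure_eq_bot_iff).mpr h)
  obtain ⟨m, -, w⟩ := exists_walk_shortEdges (hs ha) (hv a ha)
  obtain ⟨f, hf, hfT, m', -, h, wh, hh⟩ := hT.exists_exit w (hv a ha) ha1
  refine ⟨⟨f, hfT⟩, ⟨hf, hf, 0, 1, .nil, one_smul _ _⟩, ?_⟩
  rw [Subgroup.closure_le]
  intro g hg
  obtain ⟨m, -, w⟩ := exists_walk_shortEdges (hs hg) (hv g hg)
  exact mem_conjBy.mpr (hT.loop_mem_component hf wh hh w (hv g hg))

/-- The components are generated, up to conjugacy, by elements of bounded length. -/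
lemma IsSpanningTree.component_eq_conjBy [Finite ↥(Tᶜ)]
    (hspan : ∀ (M n : ℕ) (v : V) (g : FreeGroup X), Walk (shortEdges X V M) v n g →
      ∃ m k, Walk (T ∩ shortEdges X V M) v m k ∧ k • v = g • v)
    {M : ℕ} {e : ↥(Tᶜ)} (he : Linked T M e e) :
    ∃ s ⊆ wordBall X (2 * (Nat.card ↥(Tᶜ) * (2 * M + 1)) + 1), ∃ y,
      hT.component M e = conjBy y (Subgroup.closure s) := by
  classical
  set D := Nat.card ↥(Tᶜ) * (2 * M + 1) with hD
  set v := e.1.1 with hv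
  have heS := he.1
  let s : Set (FreeGroup X) :=
    {h | h ∈ wordBall X (2 * D + 1) ∧ (hT.path v)⁻¹ * h * hT.path v ∈ hT.component M e}
  have hloop : ∀ {m h}, Walk (shortEdges X V M) v m h → h • v = v → h ∈ wordBall X (2 * D + 1) →
      h ∈ s := fun w hh hb => ⟨hb, hT.loop_mem_component heS .nil (one_smul _ _) w hh⟩
  refine ⟨s, fun h hh => hh.1, (hT.path v)⁻¹, le_antisymm ?_ ?_⟩
  · rw [IsSpanningTree.component, Subgroup.closure_le]
    rintro _ ⟨f, ⟨-, hf, n, g, w, hg⟩, rfl⟩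
    obtain ⟨m, k, wk, hk⟩ := hspan M n v g w
    obtain ⟨m', k', wk', hk'⟩ := hspan M _ v _ (w.pos (x := f.1.2) (by rw [hg]; exact hf))
    have e₁ : hT.path f.1.1 = k * hT.path v := by
      rw [← hT.path_of_walk (wk.mono Set.inter_subset_left), hk, hg]
    have e₂ : hT.path (FreeGroup.of f.1.2 • f.1.1) = k' * hT.path v := by
      rw [← hT.path_of_walk (wk'.mono Set.inter_subset_left), hk', mul_smul, hg]
    have hkf : k • v = f.1.1 := hk.trans hg
    have hk'f : k' • v = FreeGroup.of f.1.2 • f.1.1 := by rw [hk', mul_smul, hg]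
    have wl : Walk (shortEdges X V M) v _ (k'⁻¹ * (FreeGroup.of f.1.2 * k)) :=
      ((wk.mono Set.inter_subset_right).pos (x := f.1.2) (by rw [hkf]; exact hf)).trans
        (u := FreeGroup.of f.1.2 • f.1.1) (by rw [mul_smul, hkf])
        ((wk'.mono Set.inter_subset_right).symm hk'f)
    have hl : (k'⁻¹ * (FreeGroup.of f.1.2 * k)) • v = v := by
      rw [mul_smul, mul_smul, hkf, ← hk'f, inv_smul_smul]
    rw [SetLike.mem_coe, mem_conjBy]
    -- Since `T` spans the short component, the tree paths to both ends of `f` differ from the one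
    -- to `v` by walks inside the component. The conjugated basis element is thus a closed walk
    -- there.
    have hrw : (hT.path v)⁻¹⁻¹ * hT.edgeLoop f * (hT.path v)⁻¹ =
        k'⁻¹ * (FreeGroup.of f.1.2 * k) := by
      rw [IsSpanningTree.edgeLoop, e₁, e₂]
      group
    change (hT.path v)⁻¹⁻¹ * hT.edgeLoop f * (hT.path v)⁻¹ ∈ _
    rw [hrw]
    generalize k'⁻¹ * (FreeGroup.of f.1.2 * k) = c at wl hl
    have hσ : ∀ u : V, ∃ b : FreeGroup X,
        (∃ n g, Walk (shortEdges X V M) v n g ∧ g • v = u) →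
          ∃ m ≤ D, Walk (shortEdges X V M) v m b ∧ b • v = u := by
      intro u
      by_cases hu : ∃ n g, Walk (shortEdges X V M) v n g ∧ g • v = u
      · obtain ⟨n, g, w, rfl⟩ := hu
        obtain ⟨m, hm, b, wb, hb⟩ := hT.exists_bounded_walk heS.1 w
        exact ⟨b, fun _ => ⟨m, hm, wb, hb⟩⟩
      · exact ⟨1, fun h => absurd h hu⟩
    choose σ hσ using hσ
    obtain ⟨m₀, hm₀, w₀, h₀⟩ := hσ v ⟨0, 1, .nil, one_smul _ _⟩
    have hσv : σ v ∈ Subgroup.closure s := Subgroup.subset_closure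
      (hloop w₀ h₀ (wordBall_mono (by omega) w₀.mem_wordBall))
    have hc := wl.reachable_edges.mem_closure σ
    rw [hl] at hc
    have hc' : (σ v)⁻¹ * c * σ v ∈ Subgroup.closure s := by
      refine (Subgroup.closure_le _).mpr ?_ hc
      rintro _ ⟨⟨u, x⟩, ⟨hS, m, h, wh, hh⟩, rfl⟩
      simp only at hh
      obtain ⟨m₁, hm₁, w₁, h₁⟩ := hσ u ⟨m, h, wh, hh⟩
      obtain ⟨m₂, hm₂, w₂, h₂⟩ := hσ (FreeGroup.of x • u)
        ⟨_, _, wh.pos (by rw [hh]; exact hS), by rw [mul_smul, hh]⟩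
      have wl := (w₁.pos (x := x) (by rw [h₁]; exact hS)).trans
        (u := FreeGroup.of x • u) (by rw [mul_smul, h₁]) (w₂.symm h₂)
      rw [← mul_assoc] at wl
      refine Subgroup.subset_closure (hloop wl ?_ ?_)
      · simp only [mul_smul, h₁]
        rw [inv_smul_eq_iff, h₂]
      · have := mul_mem_wordBall (mul_mem_wordBall (inv_mem_wordBall w₂.mem_wordBall)
          (of_mem_wordBall x)) w₁.mem_wordBall
        exact wordBall_mono (by omega) this
    have := mul_mem (mul_mem hσv hc') (inv_mem hσv)
    simpa [mul_assoc] using this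
  · rw [conjBy_le_iff, inv_inv, Subgroup.closure_le]
    exact fun h hh => mem_conjBy.mpr hh.2

end ShortLoops

/-! ### Bases adapted to an injective homomorphism -/

section AdaptedBasis

variable {X ι G : Type*} [Group G]

lemma mulAction_quotient_smul_one (H : Subgroup (FreeGroup X)) {g : FreeGroup X} :
    g • ((1 : FreeGroup X) : FreeGroup X ⧸ H) = ((1 : FreeGroup X) : FreeGroup X ⧸ H) ↔ g ∈ H := by
  rw [← MulAction.mem_stabilizer_iff, MulAction.stabilizer_quotient]

/-- A spanning tree of the coset graph of the image of an injective homomorphism from `G` to a free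
group gives a basis of `G`. -/
lemma exists_basis_of_isSpanningTree {θ : G →* FreeGroup X} (hθ : Function.Injective θ)
    {T : Set ((FreeGroup X ⧸ θ.range) × X)}
    (hT : IsSpanningTree T ((1 : FreeGroup X) : FreeGroup X ⧸ θ.range)) :
    ∃ b : FreeGroupBasis ↥(Tᶜ) G, ∀ e, θ (b e) = hT.edgeLoop e := by
  have hr : (FreeGroup.lift fun e : ↥(Tᶜ) => hT.edgeLoop e).range = θ.range := by
    rw [hT.range_lift_edgeLoop, MulAction.stabilizer_quotient]
  let eq : FreeGroup ↥(Tᶜ) ≃* G := (MonoidHom.ofInjective hT.lift_edgeLoop_injective).trans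
    ((MulEquiv.subgroupCongr hr).trans (MonoidHom.ofInjective hθ).symm)
  refine ⟨⟨eq.symm⟩, fun e => ?_⟩
  change θ ((MonoidHom.ofInjective hθ).symm _) = _
  rw [← MonoidHom.ofInjective_apply hθ, MulEquiv.apply_symm_apply]
  simp [MonoidHom.ofInjective_apply]

lemma exists_spanningTree_basis (β : FreeGroupBasis ι G) [Nonempty ι] {θ : G →* FreeGroup X}
    (hθ : Function.Injective θ) :
    ∃ (T : Set ((FreeGroup X ⧸ θ.range) × X))
      (hT : IsSpanningTree T ((1 : FreeGroup X) : FreeGroup X ⧸ θ.range)),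
      (∀ M n v g, Walk (shortEdges X (FreeGroup X ⧸ θ.range) M) v n g →
        ∃ m k, Walk (T ∩ shortEdges X (FreeGroup X ⧸ θ.range) M) v m k ∧ k • v = g • v) ∧
      Nonempty (↥(Tᶜ) ≃ ι) ∧ ∃ b : FreeGroupBasis ↥(Tᶜ) G, ∀ e, θ (b e) = hT.edgeLoop e := by
  have hne : MulAction.stabilizer (FreeGroup X)
      ((1 : FreeGroup X) : FreeGroup X ⧸ θ.range) ≠ ⊥ := by
    rw [MulAction.stabilizer_quotient, Ne, MonoidHom.range_eq_bot_iff]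
    rintro rfl
    obtain ⟨i⟩ := ‹Nonempty ι›
    have h1 : β i = 1 := hθ rfl
    have := β.repr_apply_coe i
    rw [h1, map_one] at this
    exact FreeGroup.of_ne_one i this.symm
  obtain ⟨T, hT, hspan⟩ := exists_isSpanningTree_shortEdges _ hne
  obtain ⟨b, hb⟩ := exists_basis_of_isSpanningTree hθ hT
  -- Two bases of `G` are equinumerous, so the number of edges outside `T` does not depend on `θ`.
  exact ⟨T, hT, hspan, ⟨Equiv.ofFreeGroupEquiv (b.repr.symm.trans β.repr)⟩, b, hb⟩

/-- A nontrivial element of a free group fixes only finitely many cosets of a finitely generated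
subgroup. -/
lemma finite_fixed_cosets_freeGroup [Finite X] [Finite ι] [Nonempty ι] (β : FreeGroupBasis ι G)
    {θ : G →* FreeGroup X} (hθ : Function.Injective θ) {g : FreeGroup X} (hg : g ≠ 1) :
    {v : FreeGroup X ⧸ θ.range | g • v = v}.Finite := by
  obtain ⟨T, hT, -, ⟨e⟩, -⟩ := exists_spanningTree_basis β hθ
  have : Finite ↥(Tᶜ) := .of_equiv _ e.symm
  exact hT.finite_fixedPoints hg

/-- A basis adapted to an injective homomorphism to a free group, see `exists_adapted_basis`. -/
theorem exists_adapted_basis_freeGroup [Finite ι] [Nonempty ι] (β : FreeGroupBasis ι G)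
    {θ : G →* FreeGroup X} (hθ : Function.Injective θ) :
    ∃ (b : FreeGroupBasis ι G) (R : ℕ → ι → ι → Prop), Monotone R ∧
      (∀ M i j, R M i j → R M j i) ∧ (∀ M i j k, R M i j → R M j k → R M i k) ∧
      (∀ M i, R M i i → ∃ s ⊆ wordBall X (2 * (Nat.card ι * (2 * M + 1)) + 1), ∃ y,
        (Subgroup.closure (b '' {j | R M i j})).map θ = conjBy y (Subgroup.closure s)) ∧
      ∀ M (K : Subgroup G), K ≠ ⊥ → ∀ s ⊆ wordBall X M, ∀ y,
        K.map θ = conjBy y (Subgroup.closure s) →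
        ∃ i, R M i i ∧ ∃ x, K ≤ conjBy x (Subgroup.closure (b '' {j | R M i j})) := by
  obtain ⟨T, hT, hspan, ⟨e⟩, b, hb⟩ := exists_spanningTree_basis β hθ
  have : Finite ↥(Tᶜ) := .of_equiv _ e.symm
  have hcomp : ∀ M i, (Subgroup.closure ((b.reindex e) '' {j | Linked T M (e.symm i) (e.symm j)})).map
      θ = hT.component M (e.symm i) := by
    intro M i
    rw [MonoidHom.map_closure, IsSpanningTree.component]
    congr 1
    ext g
    constructor
    · rintro ⟨_, ⟨j, hj, rfl⟩, rfl⟩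
      exact ⟨e.symm j, hj, by simp [hb]⟩
    · rintro ⟨f, hf, rfl⟩
      exact ⟨_, ⟨e f, by simpa using hf, rfl⟩, by simp [hb]⟩
  refine ⟨b.reindex e, fun M i j => Linked T M (e.symm i) (e.symm j),
    fun M N h i j hl => hl.mono h, fun M i j hl => hl.symm, fun M i j k hl hl' => hl.trans hl',
    fun M i hi => ?_, fun M K hK s hs y hy => ?_⟩
  · rw [hcomp]
    obtain ⟨s, hs, y, h⟩ := hT.component_eq_conjBy hspan hi
    rw [Nat.card_congr e] at hs
    exact ⟨s, hs, y, h⟩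
  · have hne : Subgroup.closure s ≠ ⊥ := by
      intro h
      rw [h, conjBy_eq_bot_iff.mpr rfl, Subgroup.map_eq_bot_iff_of_injective _ hθ] at hy
      exact hK hy
    have hfix : ∀ g ∈ s, g • (y⁻¹ • ((1 : FreeGroup X) : FreeGroup X ⧸ θ.range)) =
        y⁻¹ • ((1 : FreeGroup X) : FreeGroup X ⧸ θ.range) := by
      intro g hg
      rw [eq_inv_smul_iff, ← mul_smul, ← mul_smul, mulAction_quotient_smul_one]
      have : y * g * y⁻¹ ∈ K.map θ := by
        rw [hy, mem_conjBy]
        simpa [mul_assoc] using Subgroup.subset_closure hg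
      exact Subgroup.map_le_range θ K this
    obtain ⟨f, hf, hle⟩ := hT.exists_component hs hfix hne
    obtain ⟨z, hz⟩ : y * hT.path (y⁻¹ • ((1 : FreeGroup X) : FreeGroup X ⧸ θ.range)) ∈ θ.range := by
      rw [← mulAction_quotient_smul_one, mul_smul, hT.path_smul, smul_inv_smul]
    refine ⟨e f, by simpa using hf, z, ?_⟩
    rw [← Subgroup.map_le_map_iff_of_injective hθ, map_conjBy, hz, hcomp, hy,
      Equiv.symm_apply_apply, ← conjBy_conjBy]
    exact conjBy_mono y hle

variable {F : Type*} [Group F]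

/-- The elements of length at most `n` with respect to a basis. -/
def basisBall (β : FreeGroupBasis X F) (n : ℕ) : Set F := β.repr ⁻¹' wordBall X n

lemma basisBall_finite [Finite X] (β : FreeGroupBasis X F) (n : ℕ) : (basisBall β n).Finite :=
  (wordBall_finite n).preimage β.repr.injective.injOn

lemma exists_subset_basisBall (β : FreeGroupBasis X F) {s : Set F} (hs : s.Finite) :
    ∃ n, ∀ m ≥ n, s ⊆ basisBall β m := by
  obtain ⟨n, hn⟩ := exists_forall_mem_wordBall (hs.image β.repr)
  exact ⟨n, fun m hm g hg => wordBall_mono hm (hn ⟨g, hg, rfl⟩)⟩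

/-- A basis of `G` adapted to an injective homomorphism `ψ : G → F`: for each length `M`, disjoint
parts of the basis generate subgroups whose images are generated, up to conjugacy, by elements of
bounded length, and which carry each subgroup whose image is generated by elements of length at
most `M` up to conjugacy. -/
theorem exists_adapted_basis [Finite ι] [Nonempty ι] (β : FreeGroupBasis ι G)
    (δ : FreeGroupBasis X F) {ψ : G →* F} (hψ : Function.Injective ψ) :
    ∃ (b : FreeGroupBasis ι G) (R : ℕ → ι → ι → Prop), Monotone R ∧
      (∀ M i j, R M i j → R M j i) ∧ (∀ M i j k, R M i j → R M j k → R M i k) ∧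
      (∀ M i, R M i i → ∃ s ⊆ basisBall δ (2 * (Nat.card ι * (2 * M + 1)) + 1), ∃ y,
        (Subgroup.closure (b '' {j | R M i j})).map ψ = conjBy y (Subgroup.closure s)) ∧
      ∀ M (K : Subgroup G), K ≠ ⊥ → ∀ s ⊆ basisBall δ M, ∀ y,
        K.map ψ = conjBy y (Subgroup.closure s) →
        ∃ i, R M i i ∧ ∃ x, K ≤ conjBy x (Subgroup.closure (b '' {j | R M i j})) := by
  obtain ⟨b, R, h₁, h₂, h₃, h₄, h₅⟩ := exists_adapted_basis_freeGroup β
    (θ := δ.repr.toMonoidHom.comp ψ) (δ.repr.injective.comp hψ)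
  refine ⟨b, R, h₁, h₂, h₃, fun M i hi => ?_, fun M K hK s hs y hy => ?_⟩
  · obtain ⟨s, hs, y, h⟩ := h₄ M i hi
    refine ⟨δ.repr ⁻¹' s, fun g hg => hs hg, δ.repr.symm y, ?_⟩
    apply Subgroup.map_injective (f := δ.repr.toMonoidHom) δ.repr.injective
    rw [Subgroup.map_map, h, map_conjBy, MonoidHom.map_closure]
    congr 1
    · simp
    · congr 1
      exact (Set.image_preimage_eq _ δ.repr.surjective).symm
  · refine h₅ M K hK (δ.repr '' s) (by rintro _ ⟨g, hg, rfl⟩; exact hs hg) (δ.repr y) ?_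
    rw [← Subgroup.map_map, hy, map_conjBy, MonoidHom.map_closure]
    rfl

/-- A nontrivial element fixes only finitely many cosets of a finitely generated subgroup. -/
lemma finite_fixed_cosets [Finite X] [Finite ι] [Nonempty ι] (β : FreeGroupBasis ι G)
    (δ : FreeGroupBasis X F) {ψ : G →* F} (hψ : Function.Injective ψ) {g : F} (hg : g ≠ 1) :
    {v : F ⧸ ψ.range | g • v = v}.Finite := by
  have h := finite_fixed_cosets_freeGroup β (θ := δ.repr.toMonoidHom.comp ψ)
    (δ.repr.injective.comp hψ) (g := δ.repr g) (by simpa using hg)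
  have hmem : ∀ a : F, a ∈ ψ.range ↔ δ.repr a ∈ (δ.repr.toMonoidHom.comp ψ).range := by
    intro a
    simp [MonoidHom.mem_range]
  let q : F ⧸ ψ.range → FreeGroup X ⧸ (δ.repr.toMonoidHom.comp ψ).range :=
    Quotient.map' δ.repr fun a c hac => by
      rw [QuotientGroup.leftRel_apply] at hac ⊢
      rwa [← map_inv, ← map_mul, ← hmem]
  have hq : Function.Injective q := by
    rintro ⟨a⟩ ⟨c⟩ hac
    have hac' : (QuotientGroup.mk (δ.repr a) : FreeGroup X ⧸ _) = QuotientGroup.mk (δ.repr c) := hac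
    rw [QuotientGroup.eq, ← map_inv, ← map_mul, ← hmem] at hac'
    exact QuotientGroup.eq.mpr hac'
  refine (h.preimage hq.injOn).subset ?_
  rintro ⟨a⟩ ha
  have ha' : (QuotientGroup.mk (g * a) : F ⧸ ψ.range) = QuotientGroup.mk a := ha
  have := congrArg q ha'
  change (QuotientGroup.mk (δ.repr (g * a)) : FreeGroup X ⧸ _) = QuotientGroup.mk (δ.repr a) at this
  rw [map_mul] at this
  exact this

end AdaptedBasis

/-! ### Free factors, finite generation and conjugates -/

section Basis

variable {X ι F H : Type*} [Group F] [Group H]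

/-- A finitely generated group has finitely many homomorphisms to a group of order two, and on a
basis these are arbitrary functions. -/
lemma finite_of_basis_of_fg [Group.FG F] (b : FreeGroupBasis ι F) : Finite ι := by
  classical
  obtain ⟨s, hs⟩ := Group.FG.out (G := F)
  have h₁ : Function.Injective
      (fun (f : F →* Multiplicative (ZMod 2)) (g : s) => f g) := fun f g h =>
    MonoidHom.eq_of_eqOn_dense hs fun a ha => congrFun h ⟨a, ha⟩
  have : Finite (F →* Multiplicative (ZMod 2)) :=
    have : Finite (Multiplicative (ZMod 2)) := inferInstanceAs (Finite (ZMod 2))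
    .of_injective _ h₁
  have : Finite (ι → Multiplicative (ZMod 2)) := .of_equiv _ b.lift.symm
  refine .of_injective (fun i : ι => fun j => if j = i then Multiplicative.ofAdd (1 : ZMod 2) else 1)
    fun i j h => ?_
  by_contra hij
  have := congrFun h i
  simp only [if_true, if_neg hij] at this
  exact one_ne_zero (Multiplicative.ofAdd.injective this)

lemma closure_range_basis (b : FreeGroupBasis ι F) : Subgroup.closure (Set.range b) = ⊤ := by
  have h : Set.range b = b.repr.symm.toMonoidHom '' Set.range FreeGroup.of := by
    rw [← Set.range_comp]; rfl
  rw [h, ← MonoidHom.map_closure, FreeGroup.closure_range_of, ← MonoidHom.range_eq_map,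
    MonoidHom.range_eq_top]
  exact b.repr.symm.surjective

lemma basis_ne_one (b : FreeGroupBasis ι F) (i : ι) : b i ≠ 1 := by
  intro h
  have := b.repr_apply_coe i
  rw [h, map_one] at this
  exact FreeGroup.of_ne_one i this.symm

lemma hom_ext_of_eq_closure {A : Subgroup F} {t : Set F} (hA : A = Subgroup.closure t)
    {f g : A →* H} (h : ∀ a (ha : a ∈ A), a ∈ t → f ⟨a, ha⟩ = g ⟨a, ha⟩) : f = g := by
  subst hA
  ext ⟨a, ha⟩
  induction ha using Subgroup.closure_induction with
  | mem a hat => exact h a _ hat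
  | one => exact (map_one f).trans (map_one g).symm
  | mul a c ha hc iha ihc =>
    have := congrArg₂ (· * ·) iha ihc
    simp only [← map_mul] at this
    exact this
  | inv a ha iha =>
    have := congrArg (·⁻¹) iha
    simp only [← map_inv] at this
    exact this

lemma isFreeFactor_closure_basis (b : FreeGroupBasis ι F) (U : Set ι) :
    IsFreeFactor (Subgroup.closure (b '' U)) := by
  classical
  refine ⟨Subgroup.closure (b '' Uᶜ), ?_, ?_⟩
  · let ρ : F →* Monoid.Coprod (Subgroup.closure (b '' U)) (Subgroup.closure (b '' Uᶜ)) :=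
      b.lift fun i => if h : i ∈ U then
        Monoid.Coprod.inl ⟨b i, Subgroup.subset_closure ⟨i, h, rfl⟩⟩ else
        Monoid.Coprod.inr ⟨b i, Subgroup.subset_closure ⟨i, h, rfl⟩⟩
    have hρ : ∀ i, ρ (b i) = _ := fun i => congrFun (b.lift.symm_apply_apply _) i
    have : ρ.comp (Monoid.Coprod.lift (Subgroup.closure (b '' U)).subtype
        (Subgroup.closure (b '' Uᶜ)).subtype) = MonoidHom.id _ := by
      apply Monoid.Coprod.hom_ext
      · refine hom_ext_of_eq_closure rfl ?_
        rintro _ ha ⟨i, hi, rfl⟩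
        simp [hρ, hi]
      · refine hom_ext_of_eq_closure rfl ?_
        rintro _ ha ⟨i, hi, rfl⟩
        have hi' : i ∉ U := hi
        simp [hρ, hi']
    exact Function.LeftInverse.injective (g := ρ) fun a => DFunLike.congr_fun this a
  · rw [← MonoidHom.range_eq_top, Monoid.Coprod.range_lift, Subgroup.range_subtype,
      Subgroup.range_subtype, ← Subgroup.closure_union, ← Set.image_union, Set.union_compl_self,
      Set.image_univ, closure_range_basis]

/-- Disjoint parts of a basis generate a free factor system. -/
lemma isNontrivialFreeFactorSystem_of_basis (b : FreeGroupBasis ι F) {𝒜 : Finset (Subgroup F)}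
    (h𝒜 : 𝒜.Nonempty) (S : 𝒜 → Set ι) (hS : ∀ A : 𝒜, (A : Subgroup F) = Subgroup.closure (b '' S A))
    (hne : ∀ A, (S A).Nonempty) (hdisj : ∀ A B i, i ∈ S A → i ∈ S B → A = B) :
    IsNontrivialFreeFactorSystem 𝒜 := by
  classical
  have hmem : ∀ A i, i ∈ S A → b i ∈ (A : Subgroup F) := by
    intro A i hi
    rw [hS A]
    exact Subgroup.subset_closure ⟨i, hi, rfl⟩
  refine ⟨h𝒜, fun A hA hbot => ?_, ?_, ?_⟩
  · obtain ⟨i, hi⟩ := hne ⟨A, hA⟩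
    have := hmem ⟨A, hA⟩ i hi
    simp only [hbot] at this
    exact basis_ne_one b i (Subgroup.mem_bot.mp this)
  · let ρ : F →* Monoid.CoprodI fun A : 𝒜 => (A : Subgroup F) :=
      b.lift fun i => if h : ∃ A, i ∈ S A then
        Monoid.CoprodI.of (i := h.choose) ⟨b i, hmem _ _ h.choose_spec⟩ else 1
    have hρ : ∀ i, ρ (b i) = _ := fun i => congrFun (b.lift.symm_apply_apply _) i
    have hρ' : ∀ A i (hi : i ∈ S A), ρ (b i) = Monoid.CoprodI.of (i := A) ⟨b i, hmem _ _ hi⟩ := by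
      intro A i hi
      have h : ∃ A, i ∈ S A := ⟨A, hi⟩
      rw [hρ, dif_pos h]
      have : ∀ B (hB : i ∈ S B), B = A → Monoid.CoprodI.of
          (M := fun A : 𝒜 => (A : Subgroup F)) (i := B) ⟨b i, hmem _ _ hB⟩ =
          Monoid.CoprodI.of (i := A) ⟨b i, hmem _ _ hi⟩ := by
        rintro B hB rfl
        rfl
      exact this _ h.choose_spec (hdisj _ _ i h.choose_spec hi)
    have : ρ.comp (Monoid.CoprodI.lift fun A : 𝒜 => (A : Subgroup F).subtype) =
        MonoidHom.id _ := by
      refine Monoid.CoprodI.ext_hom _ _ fun A => hom_ext_of_eq_closure (hS A) ?_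
      rintro _ ha ⟨i, hi, rfl⟩
      simp [hρ' A i hi]
    exact Function.LeftInverse.injective (g := ρ) fun a => DFunLike.congr_fun this a
  · have : (⨆ A ∈ 𝒜, A) = Subgroup.closure (b '' ⋃ A, S A) := by
      rw [Set.image_iUnion, Subgroup.closure_iUnion, iSup_subtype']
      exact iSup_congr hS
    rw [this]
    exact isFreeFactor_closure_basis b _

/-- Killing the other free factors maps `F` onto each component. -/
lemma IsNontrivialFreeFactorSystem.isFG [Group.FG F] {𝒜 : Finset (Subgroup F)}
    (h𝒜 : IsNontrivialFreeFactorSystem 𝒜) : IsFG 𝒜 := by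
  classical
  obtain ⟨-, -, hinj, C, hC⟩ := h𝒜
  intro A hA
  have hr : (Monoid.CoprodI.lift fun A : 𝒜 => (A : Subgroup F).subtype).range = ⨆ A ∈ 𝒜, A := by
    rw [Monoid.CoprodI.range_eq_iSup, iSup_subtype']
    simp
  let e := MulEquiv.ofBijective _ hC
  let e' := (MonoidHom.ofInjective hinj).trans (MulEquiv.subgroupCongr hr)
  let p : (Monoid.CoprodI fun A : 𝒜 => (A : Subgroup F)) →* A :=
    Monoid.CoprodI.lift fun B => if h : B = ⟨A, hA⟩ then
      (MulEquiv.subgroupCongr (congrArg Subtype.val h)).toMonoidHom else 1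
  let f : F →* A := (p.comp e'.symm.toMonoidHom).comp (Monoid.Coprod.fst.comp e.symm.toMonoidHom)
  have hf : Function.Surjective f := by
    have hp : Function.Surjective p := fun a =>
      ⟨Monoid.CoprodI.of (M := fun A : 𝒜 => (A : Subgroup F)) (i := ⟨A, hA⟩) a, by
        simp only [p, Monoid.CoprodI.lift_of]
        simp
        rfl⟩
    exact (hp.comp e'.symm.surjective).comp (Monoid.Coprod.fst_surjective.comp e.symm.surjective)
  have : Group.FG A := Group.fg_of_surjective hf
  exact (Group.fg_iff_subgroup_fg A).mp this

lemma IsFreeFactorSystem.isFG [Group.FG F] {𝒜 : Finset (Subgroup F)}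
    (h𝒜 : IsFreeFactorSystem 𝒜) : IsFG 𝒜 := by
  rcases h𝒜 with rfl | h
  · intro A hA
    rw [Finset.mem_singleton.mp hA]
    exact Subgroup.FG.bot
  · exact h.isFG

/-- A finitely generated subgroup of a free group is not properly contained in a conjugate of
itself. -/
lemma eq_conjBy_of_le [Finite X] (δ : FreeGroupBasis X F) {B : Subgroup F} (hB : B.FG) {x : F}
    (h : B ≤ conjBy x B) : B = conjBy x B := by
  by_cases hbot : B = ⊥
  · rw [hbot, conjBy_eq_bot_iff.mpr rfl]
  have : IsFreeGroup F := δ.isFreeGroup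
  have : IsFreeGroup B := subgroupIsFreeOfIsFree B
  have : Group.FG B := (Group.fg_iff_subgroup_fg B).mpr hB
  have : Finite (IsFreeGroup.Generators B) := finite_of_basis_of_fg (IsFreeGroup.basis B)
  obtain ⟨⟨g, hg⟩, hg1⟩ := Subgroup.ne_bot_iff_exists_ne_one.mp hbot
  have : Nonempty (IsFreeGroup.Generators B) := by
    by_contra hemp
    rw [not_nonempty_iff] at hemp
    apply hg1
    have := closure_range_basis (IsFreeGroup.basis B)
    rw [Set.range_eq_empty, Subgroup.closure_empty] at this
    exact Subgroup.mem_bot.mp (this ▸ Subgroup.mem_top _)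
  have hfin := finite_fixed_cosets (IsFreeGroup.basis B) δ (ψ := B.subtype) Subtype.val_injective
    (g := g) (by simpa [Subtype.ext_iff] using hg1)
  rw [Subgroup.range_subtype] at hfin
  have hpow : ∀ k : ℕ, B ≤ conjBy (x ^ k) B := by
    intro k
    induction k with
    | zero => simp
    | succ k ih =>
      rw [pow_succ', ← conjBy_conjBy]
      exact h.trans (conjBy_mono x ih)
  -- A nontrivial `g` in `B` fixes all the cosets of powers of `x`, but only finitely many cosets in
  -- total. So a positive power of `x` lies in `B` and normalizes it, which closes the ascending
  -- chain of conjugates.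
  have hmaps : ∀ k : ℕ, ((x ^ k : F) : F ⧸ B) ∈ {v : F ⧸ B | g • v = v} := by
    intro k
    have := hpow k hg
    rw [mem_conjBy] at this
    change ((g * x ^ k : F) : F ⧸ B) = ((x ^ k : F) : F ⧸ B)
    rw [eq_comm, QuotientGroup.eq, ← mul_assoc]
    exact this
  obtain ⟨j, k, hjk, hk⟩ : ∃ j k : ℕ, j < k ∧ ((x ^ j : F) : F ⧸ B) = ((x ^ k : F) : F ⧸ B) := by
    have := hfin.to_subtype
    obtain ⟨j, k, hne, h⟩ := Finite.exists_ne_map_eq_of_infinite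
      fun k : ℕ => (⟨_, hmaps k⟩ : {v : F ⧸ B | g • v = v})
    rw [Subtype.mk.injEq] at h
    rcases hne.lt_or_gt with h' | h'
    · exact ⟨j, k, h', h⟩
    · exact ⟨k, j, h', h.symm⟩
  obtain ⟨d, rfl⟩ := Nat.exists_eq_add_of_lt hjk
  have hd : x ^ (d + 1) ∈ B := by
    rw [QuotientGroup.eq] at hk
    simpa [pow_add, add_assoc] using hk
  refine le_antisymm h ?_
  have := conjBy_mono x (hpow d)
  rw [conjBy_conjBy, ← pow_succ'] at this
  refine this.trans fun a ha => ?_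
  rw [mem_conjBy] at ha
  have := mul_mem (mul_mem hd ha) (inv_mem hd)
  simpa [mul_assoc] using this

end Basis

/-! ### Carrying of single subgroups as a preorder -/

section Relations

variable {F : Type*} [Group F]

/-- `A` is conjugate to `B`. -/
def ConjSub (A B : Subgroup F) : Prop := ∃ x : F, A = conjBy x B

/-- `A` lies in a conjugate of `B`. -/
def SubConj (A B : Subgroup F) : Prop := ∃ x : F, A ≤ conjBy x B

variable {A B C : Subgroup F}

lemma ConjSub.refl (A : Subgroup F) : ConjSub A A := ⟨1, by simp⟩

lemma ConjSub.symm (h : ConjSub A B) : ConjSub B A := by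
  obtain ⟨x, rfl⟩ := h
  exact ⟨x⁻¹, by simp [conjBy_conjBy]⟩

lemma ConjSub.trans (h : ConjSub A B) (h' : ConjSub B C) : ConjSub A C := by
  obtain ⟨x, rfl⟩ := h
  obtain ⟨y, rfl⟩ := h'
  exact ⟨x * y, by simp [conjBy_conjBy]⟩

lemma ConjSub.map (h : ConjSub A B) (f : F →* F) : ConjSub (A.map f) (B.map f) := by
  obtain ⟨x, rfl⟩ := h
  exact ⟨f x, map_conjBy f x B⟩

lemma ConjSub.subConj (h : ConjSub A B) : SubConj A B := h.imp fun _ h => h.le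

lemma SubConj.refl (A : Subgroup F) : SubConj A A := (ConjSub.refl A).subConj

lemma SubConj.trans (h : SubConj A B) (h' : SubConj B C) : SubConj A C := by
  obtain ⟨x, hx⟩ := h
  obtain ⟨y, hy⟩ := h'
  exact ⟨x * y, hx.trans (by rw [← conjBy_conjBy]; exact conjBy_mono x hy)⟩

lemma SubConj.map (h : SubConj A B) (f : F →* F) : SubConj (A.map f) (B.map f) := by
  obtain ⟨x, hx⟩ := h
  exact ⟨f x, by rw [← map_conjBy]; exact Subgroup.map_mono hx⟩

variable {X : Type*} [Finite X]

lemma eq_of_le_of_subConj (δ : FreeGroupBasis X F) (hA : A.FG) (h : A ≤ B) (h' : SubConj B A) :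
    A = B := by
  obtain ⟨z, hz⟩ := h'
  exact le_antisymm h (hz.trans (eq_conjBy_of_le δ hA (h.trans hz)).ge)

lemma SubConj.antisymm (δ : FreeGroupBasis X F) (hA : A.FG) (h : SubConj A B) (h' : SubConj B A) :
    ConjSub A B := by
  obtain ⟨x, hx⟩ := h
  refine ⟨x, eq_of_le_of_subConj δ hA hx (SubConj.trans ⟨x, le_rfl⟩ h')⟩

/-- A finite preorder has a cofinal antichain. -/
lemma exists_cofinal_antichain {α : Type*} (D : Finset α) (r : α → α → Prop) (hr : ∀ a, r a a)
    (htr : ∀ a b c, r a b → r b c → r a c) :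
    ∃ Q ⊆ D, (∀ a ∈ D, ∃ q ∈ Q, r a q) ∧ ∀ p ∈ Q, ∀ q ∈ Q, r p q → p = q := by
  classical
  let P : Finset α → Prop := fun Q => ∀ a ∈ D, ∃ q ∈ Q, r a q
  -- In a cofinal subset of least cardinality no element lies below another, since it could be
  -- dropped.
  obtain ⟨Q, hQ, hmin⟩ := Finset.exists_min_image (D.powerset.filter P) Finset.card
    ⟨D, Finset.mem_filter.mpr ⟨Finset.mem_powerset_self D, fun a ha => ⟨a, ha, hr a⟩⟩⟩
  rw [Finset.mem_filter, Finset.mem_powerset] at hQ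
  refine ⟨Q, hQ.1, hQ.2, fun p hp q hq hpq => ?_⟩
  by_contra hne
  have := hmin (Q.erase p) (by
    rw [Finset.mem_filter, Finset.mem_powerset]
    refine ⟨(Finset.erase_subset _ _).trans hQ.1, fun a ha => ?_⟩
    obtain ⟨c, hc, hac⟩ := hQ.2 a ha
    by_cases hcp : c = p
    · exact ⟨q, Finset.mem_erase.mpr ⟨Ne.symm hne, hq⟩, htr _ _ _ (hcp ▸ hac) hpq⟩
    · exact ⟨c, Finset.mem_erase.mpr ⟨hcp, hc⟩, hac⟩)
  exact absurd this (not_le.mpr (Finset.card_erase_lt_of_mem hp))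

end Relations

/-! ### Infinite tails of subgroups -/

section Tail

variable {F : Type*} [Group F] (φ : F →* F)

/-- The `n`-th iterate of an endomorphism. -/
def iterHom : ℕ → F →* F
  | 0 => MonoidHom.id F
  | n + 1 => φ.comp (iterHom n)

lemma iterHom_apply (n : ℕ) (g : F) : iterHom φ n g = φ^[n] g := by
  induction n with
  | zero => rfl
  | succ n ih => rw [Function.iterate_succ_apply', ← ih]; rfl

lemma map_iterHom_succ (n : ℕ) (K : Subgroup F) :
    K.map (iterHom φ (n + 1)) = (K.map (iterHom φ n)).map φ := by
  rw [Subgroup.map_map]; rfl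

lemma map_iterHom_add (m n : ℕ) (K : Subgroup F) :
    K.map (iterHom φ (m + n)) = (K.map (iterHom φ n)).map (iterHom φ m) := by
  rw [Subgroup.map_map]
  congr 1
  ext g
  simp [iterHom_apply, Function.iterate_add_apply]

variable {φ}

lemma iterHom_injective (hφ : Function.Injective φ) (n : ℕ) : Function.Injective (iterHom φ n) := by
  intro a c h
  rw [iterHom_apply, iterHom_apply] at h
  exact hφ.iterate n h

variable (φ) in
/-- The conjugacy class of the subgroup `K` has an infinite tail. -/
def SubgroupTail (K : Subgroup F) : Prop :=
  ∀ n, ∃ L : Subgroup F, ConjSub (L.map (iterHom φ n)) K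

lemma SubgroupTail.map {K : Subgroup F} (h : SubgroupTail φ K) : SubgroupTail φ (K.map φ) := by
  intro n
  obtain ⟨L, hL⟩ := h n
  refine ⟨L.map φ, ?_⟩
  have : (L.map φ).map (iterHom φ n) = (L.map (iterHom φ n)).map φ := by
    rw [← map_iterHom_succ, map_iterHom_add]
    rfl
  rw [this]
  exact hL.map φ

lemma HasInfiniteTail.subgroupTail {g : F} (h : HasInfiniteTail φ g) :
    SubgroupTail φ (Subgroup.zpowers g) := by
  intro n
  rcases Nat.eq_zero_or_pos n with rfl | hn
  · exact ⟨Subgroup.zpowers g, 1, by simp [iterHom]⟩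
  obtain ⟨a, ha⟩ := h n hn
  obtain ⟨c, hc⟩ := isConj_iff.mp ha
  refine ⟨Subgroup.zpowers a, ConjSub.symm ⟨c, ?_⟩⟩
  rw [MonoidHom.map_zpowers, iterHom_apply, conjBy, MonoidHom.map_zpowers, ← hc]
  rfl

/-- Running the permutation backwards `n` times finds a component whose `φ ^ n`-image is conjugate
to `B`. -/
lemma IsFixed.subgroupTail {ℬ : Finset (Subgroup F)} (h : IsFixed φ ℬ) {B : Subgroup F}
    (hB : B ∈ ℬ) : SubgroupTail φ B := by
  obtain ⟨σ, hσ⟩ := h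
  have key : ∀ n (A : ℬ), ConjSub ((A : Subgroup F).map (iterHom φ n)) ((σ ^ n) A : ℬ) := by
    intro n
    induction n with
    | zero => exact fun A => ⟨1, by simp [iterHom]⟩
    | succ n ih =>
      intro A
      rw [map_iterHom_succ, pow_succ']
      exact ((ih A).map φ).trans (hσ _)
  intro n
  refine ⟨((σ ^ n)⁻¹ ⟨B, hB⟩ : ℬ), ?_⟩
  simpa using key n ((σ ^ n)⁻¹ ⟨B, hB⟩)

lemma fg_of_fg_map (hφ : Function.Injective φ) {K : Subgroup F} (h : (K.map φ).FG) : K.FG := by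
  have : Group.FG (K.map φ) := (Group.fg_iff_subgroup_fg _).mpr h
  have : Group.FG K := Group.fg_of_surjective (f := (K.equivMapOfInjective φ hφ).symm.toMonoidHom)
    (K.equivMapOfInjective φ hφ).symm.surjective
  exact (Group.fg_iff_subgroup_fg K).mp this

lemma ConjSub.fg {A B : Subgroup F} (h : ConjSub A B) (hB : B.FG) : A.FG := by
  obtain ⟨x, rfl⟩ := h
  refine fg_of_fg_map (φ := (MulAut.conj x⁻¹).toMonoidHom) (MulAut.conj x⁻¹).injective ?_
  change (conjBy x⁻¹ (conjBy x B)).FG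
  simpa [conjBy_conjBy] using hB

lemma ConjSub.ne_bot {A B : Subgroup F} (h : ConjSub A B) (hB : B ≠ ⊥) : A ≠ ⊥ := by
  obtain ⟨x, rfl⟩ := h
  rwa [Ne, conjBy_eq_bot_iff]

lemma ne_bot_of_map_ne_bot {A : Subgroup F} (h : A.map φ ≠ ⊥) : A ≠ ⊥ := by
  rintro rfl
  exact h (Subgroup.map_bot φ)

/-- A nontrivial subgroup with an infinite tail is, up to conjugacy, the image of a subgroup with an
infinite tail. -/
lemma SubgroupTail.exists_preimage {X : Type*} [Finite X] [Nonempty X] (δ : FreeGroupBasis X F)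
    (hφ : Function.Injective φ) {K : Subgroup F} (hK : K ≠ ⊥) (h : SubgroupTail φ K) :
    ∃ L : Subgroup F, SubgroupTail φ L ∧ ConjSub (L.map φ) K := by
  obtain ⟨⟨g, hg⟩, hg1⟩ := Subgroup.ne_bot_iff_exists_ne_one.mp hK
  have hfin := finite_fixed_cosets δ δ hφ (g := g) (by simpa [Subtype.ext_iff] using hg1)
  -- The extra iterate keeps one `φ` outermost. The candidates `φ ^ n (L n)` need not be conjugate
  -- for different `n`, although their `φ`-images are. A nontrivial element of `K` fixes all the
  -- cosets of the `(y n)⁻¹`, so infinitely many of these cosets agree; for those `n` the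
  -- conjugators differ by elements of `φ.range` and pull back.
  choose L y hL using fun n : ℕ => h (n + 1)
  simp only [map_iterHom_succ] at hL
  have hmem : ∀ n, (((y n)⁻¹ : F) : F ⧸ φ.range) ∈ {v : F ⧸ φ.range | g • v = v} := by
    intro n
    change ((g * (y n)⁻¹ : F) : F ⧸ φ.range) = (((y n)⁻¹ : F) : F ⧸ φ.range)
    rw [eq_comm, QuotientGroup.eq]
    have : y n * g * (y n)⁻¹ ∈ ((L n).map (iterHom φ n)).map φ := by
      rw [hL, mem_conjBy]
      simpa [mul_assoc] using hg
    simpa [mul_assoc] using Subgroup.map_le_range φ _ this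
  have := hfin.to_subtype
  obtain ⟨v, hv⟩ := Finite.exists_infinite_fiber
    fun n : ℕ => (⟨_, hmem n⟩ : {v : F ⧸ φ.range | g • v = v})
  have hinf := Set.infinite_coe_iff.mp hv
  obtain ⟨n₀, hn₀⟩ := hinf.nonempty
  refine ⟨(L n₀).map (iterHom φ n₀), fun N => ?_, y n₀, hL n₀⟩
  obtain ⟨n, hn, hNn⟩ := hinf.exists_gt N
  refine ⟨(L n).map (iterHom φ (n - N)), ?_⟩
  rw [← map_iterHom_add, Nat.add_sub_cancel' hNn.le]
  have hnn : (((y n)⁻¹ : F) : F ⧸ φ.range) = (((y n₀)⁻¹ : F) : F ⧸ φ.range) :=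
    congrArg Subtype.val (hn.trans hn₀.symm)
  rw [QuotientGroup.eq, inv_inv] at hnn
  obtain ⟨a, ha⟩ := hnn
  refine ⟨a, Subgroup.map_injective hφ ?_⟩
  rw [map_conjBy, hL, hL, conjBy_conjBy, ha]
  simp

end Tail

/-! ### Passing to a constant subsequence -/

section Limit

variable {F X : Type*} [Group F] [Finite X] [Nonempty X] {φ : F →* F}

/-- For infinitely many `n`, a basis has disjoint parts whose images under `φ ^ n` are fixed up to
conjugacy, and which carry all the subgroups whose images are of bounded length. -/
theorem exists_limit_system (δ : FreeGroupBasis X F) (hφ : Function.Injective φ) :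
    ∃ (I : Set ℕ) (b : ℕ → FreeGroupBasis X F) (R : X → X → Prop) (B : X → Subgroup F),
      I.Infinite ∧ (∀ i j, R i j → R j i) ∧ (∀ i j k, R i j → R j k → R i k) ∧
      (∃ M, ∀ i, ∃ s ⊆ basisBall δ M, B i = Subgroup.closure s) ∧
      (∀ n ∈ I, ∀ i, R i i →
        ConjSub ((Subgroup.closure (b n '' {j | R i j})).map (iterHom φ n)) (B i)) ∧
      ∀ M, ∃ N, ∀ n ∈ I, N ≤ n → ∀ K : Subgroup F, K ≠ ⊥ → ∀ s ⊆ basisBall δ M,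
        ConjSub (K.map (iterHom φ n)) (Subgroup.closure s) →
        ∃ i, R i i ∧ SubConj K (Subgroup.closure (b n '' {j | R i j})) := by
  classical
  choose b R hmono hsymm htrans hbdd hcarry using
    fun n => exists_adapted_basis δ δ (iterHom_injective hφ n)
  let E : ℕ → ℕ → Set (X × X) := fun n M => {p | R n M p.1 p.2}
  have hE : ∀ n {M N}, M ≤ N → E n M ⊆ E n N := fun n M N h p hp => hmono n h p.1 p.2 hp
  have hcard : ∀ n M, (E n M).ncard ≤ Nat.card (X × X) := fun n M => Set.ncard_le_card _
  -- Take the largest number of related pairs that is reached for infinitely many `n` at a single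
  -- `M`. Beyond the corresponding `M₀`, raising `M` adds pairs for only finitely many of these `n`.
  let P : ℕ → Prop := fun c => ∃ M, {n | c ≤ (E n M).ncard}.Infinite
  have hP0 : P 0 := ⟨0, by simpa using Set.infinite_univ⟩
  set c := Nat.findGreatest P (Nat.card (X × X)) with hc
  obtain ⟨M₀, hM₀⟩ : P c := Nat.findGreatest_spec (Nat.zero_le _) hP0
  have hcmax : ∀ M, {n | c + 1 ≤ (E n M).ncard}.Finite := by
    intro M
    by_contra hinf
    have hinf : {n | c + 1 ≤ (E n M).ncard}.Infinite := hinf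
    obtain ⟨n, hn⟩ := hinf.nonempty
    have := Nat.le_findGreatest (P := P) (le_trans hn (hcard n M)) ⟨M, hinf⟩
    omega
  have hstable : ∀ M, ∃ N, ∀ n, c ≤ (E n M₀).ncard → N ≤ n → ∀ i j, R n M i j → R n M₀ i j := by
    intro M
    obtain ⟨N, hN⟩ := (hcmax (max M M₀)).bddAbove
    refine ⟨N + 1, fun n hn hNn i j hij => ?_⟩
    have hlt : ¬c + 1 ≤ (E n (max M M₀)).ncard := fun h => by
      have := hN h
      omega
    have heq : E n M₀ = E n (max M M₀) :=
      Set.eq_of_subset_of_ncard_le (hE n (le_max_right _ _)) (by omega)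
    have : (i, j) ∈ E n (max M M₀) := hE n (le_max_left _ _) hij
    rwa [← heq] at this
  set D := 2 * (Nat.card X * (2 * M₀ + 1)) + 1 with hD
  have hs : ∀ n i, ∃ s : {s : Set F // s ⊆ basisBall δ D}, R n M₀ i i →
      ConjSub ((Subgroup.closure (b n '' {j | R n M₀ i j})).map (iterHom φ n))
        (Subgroup.closure s) := by
    intro n i
    by_cases hi : R n M₀ i i
    · obtain ⟨s, hs, h⟩ := hbdd n M₀ i hi
      exact ⟨⟨s, hs⟩, fun _ => h⟩
    · exact ⟨⟨∅, Set.empty_subset _⟩, fun h => absurd h hi⟩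
  choose s hs using hs
  have hfin : Finite {s : Set F // s ⊆ basisBall δ D} :=
    (basisBall_finite δ D).finite_subsets.to_subtype
  have : Infinite {n | c ≤ (E n M₀).ncard} := hM₀.to_subtype
  -- There are finitely many relations on `X` and finitely many generating sets inside a ball, so
  -- both can be made constant.
  obtain ⟨⟨R₀, s₀⟩, hfib⟩ := Finite.exists_infinite_fiber
    fun n : {n | c ≤ (E n M₀).ncard} => (R n M₀, s n)
  have hfib := (Set.infinite_coe_iff.mp hfib).image Subtype.val_injective.injOn
  have hI : ∀ n ∈ Subtype.val '' ((fun n : {n | c ≤ (E n M₀).ncard} => (R n M₀, s n)) ⁻¹'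
      {(R₀, s₀)}), c ≤ (E n M₀).ncard ∧ R n M₀ = R₀ ∧ s n = s₀ := by
    rintro _ ⟨n, hn, rfl⟩
    exact ⟨n.2, (Prod.mk.inj hn).1, (Prod.mk.inj hn).2⟩
  generalize Subtype.val '' ((fun n : {n | c ≤ (E n M₀).ncard} => (R n M₀, s n)) ⁻¹'
      {(R₀, s₀)}) = I at hfib hI
  obtain ⟨n₀, hn₀⟩ := hfib.nonempty
  refine ⟨I, b, R₀, fun i => Subgroup.closure (s₀ i), hfib, ?_, ?_, ⟨D, fun i => ⟨s₀ i, (s₀ i).2,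
    rfl⟩⟩, fun n hn i hi => ?_, fun M => ?_⟩
  · rw [← (hI n₀ hn₀).2.1]
    exact hsymm n₀ M₀
  · rw [← (hI n₀ hn₀).2.1]
    exact htrans n₀ M₀
  · obtain ⟨-, h₁, h₂⟩ := hI n hn
    have := hs n i (by rwa [h₁])
    rwa [h₁, h₂] at this
  · obtain ⟨N, hN⟩ := hstable M
    refine ⟨N, fun n hn hNn K hK t ht ⟨y, hy⟩ => ?_⟩
    obtain ⟨h₀, h₁, -⟩ := hI n hn
    obtain ⟨i, hi, x, hx⟩ := hcarry n M K hK t ht y hy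
    rw [← h₁]
    refine ⟨i, hN n h₀ hNn i i hi, x, hx.trans (conjBy_mono x (Subgroup.closure_mono ?_))⟩
    rintro _ ⟨j, hj, rfl⟩
    exact ⟨j, hN n h₀ hNn i j hj, rfl⟩

end Limit

/-! ### The fixed free factor system and the proposition -/

section Main

variable {F X : Type*} [Group F] {φ : F →* F}

lemma isFixed_image {κ : Type*} [Fintype κ] [DecidableEq (Subgroup F)] {A : κ → Subgroup F}
    (hA : Function.Injective A) (e : Equiv.Perm κ)
    (h : ∀ p, ConjSub ((A p).map φ) (A (e p))) : IsFixed φ (Finset.univ.image A) := by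
  let a : κ ≃ Finset.univ.image A := Equiv.ofBijective
    (fun p => ⟨A p, Finset.mem_image_of_mem A (Finset.mem_univ p)⟩)
    ⟨fun p q hpq => hA (congrArg Subtype.val hpq), fun ⟨B, hB⟩ => by
      obtain ⟨p, -, rfl⟩ := Finset.mem_image.mp hB
      exact ⟨p, rfl⟩⟩
  refine ⟨(a.symm.trans e).trans a, fun B => ?_⟩
  obtain ⟨p, rfl⟩ := a.surjective B
  have hp : ((a.symm.trans e).trans a) (a p) = a (e p) := by simp
  rw [hp]
  exact h p

/-- There is a fixed free factor system that carries all finitely generated subgroups with an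
infinite tail. -/
theorem exists_fixed_freeFactorSystem [Finite X] [Nonempty X] (δ : FreeGroupBasis X F)
    (hφ : Function.Injective φ) :
    ∃ 𝒜 : Finset (Subgroup F), IsFreeFactorSystem 𝒜 ∧ IsFixed φ 𝒜 ∧
      ∀ K : Subgroup F, K.FG → SubgroupTail φ K → ∃ A ∈ 𝒜, SubConj K A := by
  classical
  have := Fintype.ofFinite X
  obtain ⟨I, b, R, B, hI, hsymm, htrans, ⟨D, hD⟩, hB, hcarry⟩ := exists_limit_system δ hφ
  have hBfg : ∀ i, (B i).FG := by
    intro i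
    obtain ⟨s, hs, h⟩ := hD i
    rw [h, Subgroup.fg_iff]
    exact ⟨s, rfl, (basisBall_finite δ D).subset hs⟩
  obtain ⟨n₀, hn₀⟩ := hI.nonempty
  have hBne : ∀ i, R i i → B i ≠ ⊥ := by
    intro i hi
    refine (hB n₀ hn₀ i hi).symm.ne_bot ?_
    rw [Ne, Subgroup.map_eq_bot_iff_of_injective _ (iterHom_injective hφ n₀),
      Subgroup.closure_eq_bot_iff]
    exact fun h => basis_ne_one (b n₀) i (h ⟨i, hi, rfl⟩)
  -- `B i` is a `φ ^ m`-image up to conjugacy for infinitely many `m`, hence a `φ ^ n`-image for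
  -- every `n`.
  have hBtail : ∀ i, R i i → SubgroupTail φ (B i) := by
    intro i hi n
    obtain ⟨m, hm, hnm⟩ := hI.exists_gt n
    have := hB m hm i hi
    rw [← Nat.add_sub_cancel' hnm.le, map_iterHom_add] at this
    exact ⟨_, this⟩
  obtain ⟨Q, hQR, hQcof, hQanti⟩ := exists_cofinal_antichain (Finset.univ.filter fun i => R i i)
    (fun i j => SubConj (B i) (B j)) (fun i => SubConj.refl _) fun i j k => SubConj.trans
  replace hQR : ∀ q ∈ Q, R q q := fun q hq => (Finset.mem_filter.mp (hQR hq)).2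
  replace hQcof : ∀ i, R i i → ∃ q : Q, SubConj (B i) (B q) := fun i hi => by
    obtain ⟨q, hq, h⟩ := hQcof i (Finset.mem_filter.mpr ⟨Finset.mem_univ i, hi⟩)
    exact ⟨⟨q, hq⟩, h⟩
  replace hQanti : ∀ p q : Q, SubConj (B p) (B q) → p = q :=
    fun p q h => Subtype.ext (hQanti p p.2 q q.2 h)
  have hcarryQ : ∀ K : Subgroup F, K ≠ ⊥ → K.FG → SubgroupTail φ K → ∃ q : Q, SubConj K (B q) := by
    intro K hK hKfg hKt
    obtain ⟨s, rfl, hs⟩ := (Subgroup.fg_iff K).mp hKfg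
    obtain ⟨M, hM⟩ := exists_subset_basisBall δ hs
    obtain ⟨N, hN⟩ := hcarry M
    obtain ⟨n, hn, hNn⟩ := hI.exists_gt N
    obtain ⟨L, hL⟩ := hKt n
    obtain ⟨i, hi, hLi⟩ := hN n hn hNn.le L (ne_bot_of_map_ne_bot (hL.ne_bot hK)) s (hM M le_rfl) hL
    obtain ⟨q, hq⟩ := hQcof i hi
    exact ⟨q, hL.symm.subConj.trans ((hLi.map _).trans ((hB n hn i hi).subConj.trans hq))⟩
  have hmapfg : ∀ q, ((B q).map φ).FG := fun q => by
    obtain ⟨s, hs, h⟩ := hD q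
    rw [h, MonoidHom.map_closure, Subgroup.fg_iff]
    exact ⟨_, rfl, ((basisBall_finite δ D).subset hs).image _⟩
  have hσ : ∀ q : Q, ∃ p : Q, SubConj ((B q).map φ) (B p) := fun q =>
    hcarryQ _ ((Subgroup.map_eq_bot_iff_of_injective _ hφ).not.mpr (hBne q (hQR q q.2)))
      (hmapfg q) (hBtail q (hQR q q.2)).map
  choose σ hσ using hσ
  -- Pull `B q` back to some `L` with a tail, carried by `B p`. Then `B q` is carried by `φ (B p)`,
  -- hence by `B (σ p)`; the antichain forces `σ p = q`, and mutual carrying gives conjugacy.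
  have hsurj : ∀ q : Q, ∃ p, σ p = q ∧ ConjSub ((B p).map φ) (B q) := by
    intro q
    obtain ⟨L, hLt, hL⟩ := (hBtail q (hQR q q.2)).exists_preimage δ hφ (hBne q (hQR q q.2))
    obtain ⟨p, hp⟩ := hcarryQ L (ne_bot_of_map_ne_bot (hL.ne_bot (hBne q (hQR q q.2))))
      (fg_of_fg_map hφ (hL.fg (hBfg q))) hLt
    have h₁ : SubConj (B q) ((B p).map φ) := hL.symm.subConj.trans (hp.map φ)
    obtain rfl := hQanti q (σ p) (h₁.trans (hσ p))
    exact ⟨p, rfl, (h₁.antisymm δ (hBfg _) (hσ p)).symm⟩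
  have hbij : Function.Bijective σ :=
    Finite.surjective_iff_bijective.mp fun q => (hsurj q).imp fun _ h => h.1
  let e : Equiv.Perm Q := Equiv.ofBijective σ hbij
  have he : ∀ q : Q, ConjSub ((B q).map φ) (B (e q)) := by
    intro q
    obtain ⟨p, hp, h⟩ := hsurj (σ q)
    rwa [hbij.1 hp] at h
  have hepow : ∀ n (q : Q), ConjSub ((B q).map (iterHom φ n)) (B ((e ^ n) q : Q)) := by
    intro n
    induction n with
    | zero => exact fun q => ⟨1, by simp [iterHom]⟩
    | succ n ih =>
      intro q
      rw [map_iterHom_succ, pow_succ']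
      exact ((ih q).map φ).trans (he _)
  obtain ⟨N, hN⟩ := hcarry D
  obtain ⟨n, hn, hNn⟩ := hI.exists_gt N
  -- The `φ ^ n`-image of `B q` is another `B p` up to conjugacy, with generators of length at most
  -- `D`. So a single large `n` places every `B q` inside a conjugate of a basis factor, and
  -- maximality makes the inclusion an equality.
  have hrep : ∀ q : Q, ∃ i, R i i ∧ ConjSub (Subgroup.closure (b n '' {j | R i j})) (B q) := by
    intro q
    obtain ⟨s, hs, hBs⟩ := hD ((e ^ n) q : Q)
    obtain ⟨i, hi, x, hx⟩ := hN n hn hNn.le (B q) (hBne q (hQR q q.2)) s hs (hBs ▸ hepow n q)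
    obtain ⟨p, hp⟩ := hQcof i hi
    have h₁ : SubConj (B ((e ^ n) q : Q)) (B p) := (hepow n q).symm.subConj.trans
      ((SubConj.map ⟨x, hx⟩ _).trans ((hB n hn i hi).subConj.trans hp))
    obtain rfl := hQanti _ _ h₁
    refine ⟨i, hi, ConjSub.symm ⟨x, ?_⟩⟩
    apply Subgroup.map_injective (iterHom_injective hφ n)
    refine eq_of_le_of_subConj δ ((hepow n q).fg (hBfg _)) (Subgroup.map_mono hx) ?_
    refine SubConj.trans ⟨iterHom φ n x, (map_conjBy _ _ _).le⟩ ?_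
    exact (hB n hn i hi).subConj.trans (hp.trans (hepow n q).symm.subConj)
  choose i hi hiB using hrep
  -- Without maximal `B q`, no nontrivial finitely generated subgroup has an infinite tail, and the
  -- trivial system suffices.
  rcases isEmpty_or_nonempty Q with hempty | hne
  · refine ⟨{⊥}, .inl rfl, ⟨1, fun A => ⟨1, ?_⟩⟩, fun K hK hKt => ⟨⊥, by simp, 1, ?_⟩⟩
    · rw [Finset.mem_singleton.mp A.2, Finset.mem_singleton.mp (Subtype.mem _)]
      simp
    · by_contra h
      obtain ⟨q, -⟩ := hcarryQ K (fun h' => h (by simp [h'])) hK hKt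
      exact hempty.elim q
  · let A : Q → Subgroup F := fun q => Subgroup.closure (b n '' {j | R (i q) j})
    have hAinj : Function.Injective A := by
      intro p q hpq
      have hq := hiB q
      change ConjSub (A q) _ at hq
      rw [← hpq] at hq
      exact hQanti p q ((hiB p).symm.trans hq).subConj
    have hAmem : ∀ q, A q ∈ Finset.univ.image A := fun q =>
      Finset.mem_image_of_mem A (Finset.mem_univ q)
    refine ⟨Finset.univ.image A, .inr ?_, isFixed_image hAinj e fun q => ?_, fun K hK hKt => ?_⟩
    · have hidx : ∀ C : Finset.univ.image A, ∃ q, A q = C := fun C => by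
        obtain ⟨q, -, h⟩ := Finset.mem_image.mp C.2
        exact ⟨q, h⟩
      choose q hq using hidx
      refine isNontrivialFreeFactorSystem_of_basis (b n) (Finset.univ_nonempty.image A)
        (fun C => {j | R (i (q C)) j}) (fun C => (hq C).symm) (fun C => ⟨_, hi (q C)⟩) ?_
      intro C C' j hj hj'
      apply Subtype.ext
      rw [← hq C, ← hq C']
      have : {j | R (i (q C)) j} = {j | R (i (q C')) j} := by
        have h := htrans _ _ _ hj (hsymm _ _ hj')
        ext k
        exact ⟨fun hk => htrans _ _ _ (hsymm _ _ h) hk, fun hk => htrans _ _ _ h hk⟩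
      simp only [A, this]
    · exact ((hiB q).map φ).trans ((he q).trans (hiB (e q)).symm)
    · by_cases hbot : K = ⊥
      · obtain ⟨q⟩ := hne
        exact ⟨A q, hAmem q, 1, hbot ▸ bot_le⟩
      · obtain ⟨q, hq⟩ := hcarryQ K hbot hK hKt
        exact ⟨A q, hAmem q, hq.trans (hiB q).symm.subConj⟩

end Main

end SubgroupSystem

theorem mainTheorem5 {F : Type*} [Group F] [IsFreeGroup F] [Group.FG F] (hF : 2 ≤ Group.rank F)
    (φ : F →* F) (hφ : Function.Injective φ) :
    ∃ 𝒜 : Finset (Subgroup F),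
      SubgroupSystem.IsMaximalFixedFreeFactorSystem φ 𝒜 ∧
      (∀ ℬ : Finset (Subgroup F), SubgroupSystem.IsMaximalFixedFreeFactorSystem φ ℬ →
        SubgroupSystem.Equivalent ℬ 𝒜) ∧
      (∀ g : F, SubgroupSystem.HasInfiniteTail φ g → SubgroupSystem.CarriesClass 𝒜 g) ∧
      (∀ ℬ : Finset (Subgroup F), SubgroupSystem.IsSystem ℬ → SubgroupSystem.IsFG ℬ →
        SubgroupSystem.IsFixed φ ℬ → SubgroupSystem.Carries 𝒜 ℬ) := by
  have hfin : Finite (IsFreeGroup.Generators F) :=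
    SubgroupSystem.finite_of_basis_of_fg (IsFreeGroup.basis F)
  have hne : Nonempty (IsFreeGroup.Generators F) := by
    by_contra h
    rw [not_nonempty_iff] at h
    have htop := SubgroupSystem.closure_range_basis (IsFreeGroup.basis F)
    rw [Set.range_eq_empty] at htop
    have := Group.rank_le (S := (∅ : Finset F)) (by simpa using htop)
    simp only [Finset.card_empty] at this
    omega
  obtain ⟨𝒜, hfree, hfix, hcarry⟩ :=
    SubgroupSystem.exists_fixed_freeFactorSystem (IsFreeGroup.basis F) hφ
  -- Components of a fixed system have infinite tails, and free factor systems are finitely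
  -- generated. So this single statement yields maximality, uniqueness and the carrying of systems.
  have hsys : ∀ ℬ : Finset (Subgroup F), SubgroupSystem.IsFG ℬ → SubgroupSystem.IsFixed φ ℬ →
      SubgroupSystem.Carries 𝒜 ℬ := fun ℬ hfg hℬ B hB => hcarry B (hfg B hB) (hℬ.subgroupTail hB)
  refine ⟨𝒜, ⟨hfree, hfix, fun ℬ hℬ hℬfix _ => hsys ℬ hℬ.isFG hℬfix⟩, fun ℬ hℬ => ?_,
    fun g hg => ?_, fun ℬ _ hfg hℬ => hsys ℬ hfg hℬ⟩
  · have h := hsys ℬ hℬ.1.isFG hℬ.2.1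
    exact ⟨hℬ.2.2 𝒜 hfree hfix h, h⟩
  · obtain ⟨A, hA, x, hx⟩ := hcarry (Subgroup.zpowers g)
      ((Subgroup.fg_iff _).mpr ⟨{g}, (Subgroup.zpowers_eq_closure g).symm, Set.finite_singleton g⟩)
      hg.subgroupTail
    exact ⟨A, hA, x, hx (Subgroup.mem_zpowers g)⟩
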